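/- **Conventions.** Let $\mathcal H$ be a complex Hilbert space. A selfadjoint linear relation in $\mathcal H$ is a linear subspace $A\subseteq\mathcal H\times\mathcal H$ with $A^*=A$, where $A^*=\{\{g,g'\}:(f',g)=(f,g')\ \forall\{f,f'\}\in A\}$; it is nonnegative if $(f',f)\ge 0$ for all $\{f,f'\}\in A$. Put $\operatorname{dom}A=\{f:\{f,f'\}\in A\}$, $\operatorname{ran}A=\{f':\{f,f'\}\in A\}$, $\ker A=\{f:\{f,0\}\in A\}$, $\operatorname{mul}A=\{f':\{0,f'\}\in A\}$, $A^{-1}=\{\{f',f\}:\{f,f'\}\in A\}$ and $A{\upharpoonright}\mathcal L=\{\{f,f'\}\in A: f\in\mathcal L\}$. The operator part $A_o$ of a selfadjoint $A$ is the operator whose graph is $\{\{f,f'\}\in A: f'\perp\operatorname{mul}A\}$. For a nonnegative selfadjoint relation $A$, $A^{1/2}$ denotes its unique nonnegative selfadjoint square root, $A^{1/2}=\operatorname{Graph}(A_o^{1/2})\oplus(\{0\}\oplus\operatorname{mul}A)$; the associated closed form is $A[f,g]=(A_o^{1/2}f,A_o^{1/2}g)$ on $\mathcal D[A]=\operatorname{dom}A_o^{1/2}$.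 A closed nonnegative form $\mathfrak a$ is associated with $A$ if $\operatorname{dom}A\subseteq\operatorname{dom}\mathfrak a$ and $\mathfrak a[f,\psi]=(f',\psi)$ for all $\{f,f'\}\in A$, $\psi\in\operatorname{dom}\mathfrak a$. One writes $\widetilde A\le A$ if $\operatorname{dom}A_o^{1/2}\subseteq\operatorname{dom}\widetilde A_o^{1/2}$ and $\|\widetilde A_o^{1/2}f\|\le\|A_o^{1/2}f\|$ for $f\in\operatorname{dom}A_o^{1/2}$. The Cayley transform is $\mathfrak C(A)=-I+2(I+A)^{-1}$, and bounded operators are identified with their graphs. $\mathbf B^+(\mathcal H)$ is the set of bounded nonnegative selfadjoint operators on $\mathcal H$; for $S\in\mathbf B^+(\mathcal H)$ and a closed subspace $\mathcal L$, the shorted operator $S_{\mathcal L}$ is the greatest $X\in\mathbf B^+(\mathcal H)$ with $X\le S$ and $\operatorname{ran}X\subseteq\mathcal L$. **Theorem.** Let $A$ be a nonnegative selfadjoint linear relation in $\mathcal H$ and let $\mathcal L$ be a closed subspace of $\mathcal H$. Then the set $$\Xi(A,\mathcal L)=\{\widetilde A\text{ nonnegative selfadjoint linear relation}:\ \widetilde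 A\le A,\ \operatorname{ran}\widetilde A\subseteq\mathcal L\}$$ has a greatest element $A_{\mathcal L}$, which is also its unique maximal element, and $\ker A_{\mathcal L}\supseteq\mathcal L^\perp$. Moreover: 1. $A_{\mathcal L}{\upharpoonright}\mathcal L\subseteq\mathcal L\times\mathcal L$ is selfadjoint in $\mathcal L$, and $(A_{\mathcal L}{\upharpoonright}\mathcal L)^{-1}$ is associated with the closed nonnegative form $\mathfrak c_{\mathcal L}[f,g]=A^{-1}[f,g]$, $f,g\in\operatorname{dom}\mathfrak c_{\mathcal L}=\operatorname{ran}A^{1/2}\cap\mathcal L$. 2. $\operatorname{ran}(A_{\mathcal L})^{1/2}=\operatorname{ran}A^{1/2}\cap\mathcal L$; and $A_{\mathcal L}=0$ (the zero operator on $\mathcal H$) if and only if $\operatorname{ran}A^{1/2}\cap\mathcal L=\{0\}$. 3. $\mathfrak C(A)$ is a bounded operator, and $A_{\mathcal L}=\mathfrak C\bigl(I-(I-\mathfrak C(A))_{\mathcal L}\bigr)$, where the shorted operator $(I-\mathfrak C(A))_{\mathcal L}$ exists. 4. $A_{\mathcal L}$ is an operator ($\operatorname{mul}A_{\mathcal L}=\{0\}$)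 if and only if $\operatorname{mul}A\cap\mathcal L=\{0\}$. 5. Let $\mathfrak M=\{f\in\mathcal D[A]: \{f,f'\}\in A^{1/2}\text{ for some }f'\in\mathcal L\}$. Then $A_{\mathcal L}\in\mathbf B^+(\mathcal H)$ if and only if $\mathfrak M$ is closed and $\operatorname{mul}A\cap\mathcal L=\{0\}$. Consequently, $A_{\mathcal L}\in\mathbf B^+(\mathcal H)\setminus\{0\}$ if and only if $\mathfrak M$ is closed, $\operatorname{mul}A\cap\mathcal L=\{0\}$ and $\operatorname{ran}A^{1/2}\cap\mathcal L\ne\{0\}$. -/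

import Mathlib

open scoped InnerProductSpace ComplexOrder
open Filter Topology

noncomputable section

/-- Linear relations in `H`, as linear subspaces of `H × H`. (Selfadjoint relations are
automatically closed.) -/
abbrev LinRel (H : Type*) [NormedAddCommGroup H] [InnerProductSpace ℂ H] :=
  Submodule ℂ (H × H)

namespace LinRel

section Basic

variable {H : Type*} [NormedAddCommGroup H] [InnerProductSpace ℂ H]

/-- `dom A = {f | {f, f'} ∈ A}` -/
def dom (A : LinRel H) : Submodule ℂ H := A.map (LinearMap.fst ℂ H H)

/-- `ran A = {f' | {f, f'} ∈ A}` -/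
def ran (A : LinRel H) : Submodule ℂ H := A.map (LinearMap.snd ℂ H H)

/-- `ker A = {f | {f, 0} ∈ A}` -/
def ker (A : LinRel H) : Submodule ℂ H := A.comap (LinearMap.inl ℂ H H)

/-- `mul A = {f' | {0, f'} ∈ A}` -/
def mul (A : LinRel H) : Submodule ℂ H := A.comap (LinearMap.inr ℂ H H)

/-- `A⁻¹ = {{f', f} | {f, f'} ∈ A}` -/
def inv (A : LinRel H) : LinRel H :=
  A.map (LinearEquiv.prodComm ℂ H H : H × H →ₗ[ℂ] H × H)

/-- The composition `S R = {{f, h} | ∃ g, {f, g} ∈ R, {g, h} ∈ S}`. -/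
def comp (S R : LinRel H) : LinRel H where
  carrier := {x | ∃ g, (x.1, g) ∈ R ∧ (g, x.2) ∈ S}
  add_mem' := by
    rintro x y ⟨g, h1, h2⟩ ⟨k, h3, h4⟩
    exact ⟨g + k, R.add_mem h1 h3, S.add_mem h2 h4⟩
  zero_mem' := ⟨0, R.zero_mem, S.zero_mem⟩
  smul_mem' := by
    rintro c x ⟨g, h1, h2⟩
    exact ⟨c • g, R.smul_mem c h1, S.smul_mem c h2⟩

/-- The preimage `{f | ∃ f' ∈ L, {f, f'} ∈ A}` of a subspace `L` under the relation `A`. -/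
def preimage (A : LinRel H) (L : Submodule ℂ H) : Submodule ℂ H :=
  (A ⊓ (⊤ : Submodule ℂ H).prod L).map (LinearMap.fst ℂ H H)

/-- The restriction `A↾L = {{f, f'} ∈ A | f ∈ L}`. -/
def restr (A : LinRel H) (L : Submodule ℂ H) : LinRel H := A ⊓ L.prod ⊤

/-- A relation contained in `L × L`, regarded as a relation in the space `L`. -/
def inside (A : LinRel H) (L : Submodule ℂ H) : LinRel L :=
  A.comap (L.subtype.prodMap L.subtype)

/-- The graph of a bounded operator. -/
def ofOp (T : H →L[ℂ] H) : LinRel H := (T : H →ₗ[ℂ] H).graph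

/-- The Cayley transform `-I + 2(I + A)⁻¹`: the pairs of `(I + A)⁻¹` are `{f + f', f}` with
`{f, f'} ∈ A`, so those of the transform are `{f + f', -(f + f') + 2f}`. -/
def cayley (A : LinRel H) : LinRel H :=
  A.map ((LinearMap.fst ℂ H H + LinearMap.snd ℂ H H).prod
    (-(LinearMap.fst ℂ H H + LinearMap.snd ℂ H H) + (2 : ℂ) • LinearMap.fst ℂ H H))

/-- `A` is selfadjoint: `A* = A`. -/
def SelfAdj (A : LinRel H) : Prop := Submodule.adjoint A = A

/-- `A` is nonnegative: `(f', f) ≥ 0` for all `{f, f'} ∈ A`. -/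
def Nonneg (A : LinRel H) : Prop := ∀ x ∈ A, 0 ≤ ⟪x.2, x.1⟫_ℂ

/-- `A` is a nonnegative selfadjoint linear relation. -/
def NonnegSA (A : LinRel H) : Prop := A.SelfAdj ∧ A.Nonneg

/-- The operator part `A_o` of `A`, whose graph consists of the pairs `{f, f'} ∈ A` with
`f' ⟂ mul A`. It is an operator on `dom A` when `A` is closed. -/
def opPart (A : LinRel H) : H →ₗ.[ℂ] H :=
  (A ⊓ (⊤ : Submodule ℂ H).prod A.mulᗮ).toLinearPMap

/-- `R` is a nonnegative selfadjoint square root of `A`. The composition of a selfadjoint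
relation `R` with itself is `Graph(R_o²) ⊕ ({0} ⊕ mul R)`, so this says `R_o² = A_o` and
`mul R = mul A`, that is `R = Graph(A_o^{1/2}) ⊕ ({0} ⊕ mul A)`. -/
def IsSqrt (A R : LinRel H) : Prop := R.NonnegSA ∧ R.comp R = A

end Basic

/-! ### Existence and uniqueness of the square root -/

section Sqrt

variable {H : Type*} [NormedAddCommGroup H] [InnerProductSpace ℂ H]

theorem SelfAdj.mem_iff {A : LinRel H} (hA : A.SelfAdj) (x : H × H) :
    x ∈ A ↔ ∀ a b, (a, b) ∈ A → ⟪b, x.1⟫_ℂ = ⟪a, x.2⟫_ℂ := by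
  have h := Submodule.mem_adjoint_iff A x
  rw [show Submodule.adjoint A = A from hA] at h
  simpa [sub_eq_zero] using h

/-- The relation `{{P k, Q k} | k ∈ H}` for bounded operators `P`, `Q`. -/
def ofPair (P Q : H →L[ℂ] H) : LinRel H := LinearMap.range ((P : H →ₗ[ℂ] H).prod (Q : H →ₗ[ℂ] H))

theorem mem_ofPair {P Q : H →L[ℂ] H} {x : H × H} :
    x ∈ ofPair P Q ↔ ∃ k, P k = x.1 ∧ Q k = x.2 := by
  simp [ofPair, Prod.ext_iff]

theorem SelfAdj.isClosed {A : LinRel H} (hA : A.SelfAdj) : IsClosed (A : Set (H × H)) := by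
  have : (A : Set (H × H)) = ⋂ p : A, {x : H × H | ⟪p.1.2, x.1⟫_ℂ = ⟪p.1.1, x.2⟫_ℂ} := by
    ext x
    simp only [SetLike.mem_coe, hA.mem_iff x, Set.mem_iInter, Set.mem_ofPred_eq]
    exact ⟨fun h p => h _ _ p.2, fun h a b hab => h ⟨_, hab⟩⟩
  rw [this]
  refine isClosed_iInter fun p => isClosed_eq ?_ ?_ <;> fun_prop

theorem NonnegSA.re_nonneg {A : LinRel H} (hA : A.NonnegSA) {x : H × H} (hx : x ∈ A) :
    0 ≤ (⟪x.1, x.2⟫_ℂ).re := by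
  rw [← inner_conj_symm, Complex.conj_re]
  exact (Complex.le_def.1 (hA.2 x hx)).1

theorem NonnegSA.norm_le {A : LinRel H} (hA : A.NonnegSA) {x : H × H} (hx : x ∈ A) :
    ‖x.1‖ ^ 2 + ‖x.2‖ ^ 2 ≤ ‖x.1 + x.2‖ ^ 2 := by
  have h := norm_add_sq (𝕜 := ℂ) x.1 x.2
  have h2 := hA.re_nonneg hx
  simp only [RCLike.re_to_complex] at h
  linarith

variable [CompleteSpace H]

/-- `I + A` is onto. -/
theorem NonnegSA.exists_add {A : LinRel H} (hA : A.NonnegSA) (h : H) :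
    ∃ x ∈ A, x.1 + x.2 = h := by
  let S : A →ₗ[ℂ] H := (LinearMap.fst ℂ H H + LinearMap.snd ℂ H H).comp A.subtype
  have hS : ∀ x, S x = x.1.1 + x.1.2 := fun x => rfl
  have : CompleteSpace A := hA.1.isClosed.completeSpace_coe
  have hcl : IsClosed (LinearMap.range S : Set H) := by
    have hanti : AntilipschitzWith 1 S := by
      refine AddMonoidHomClass.antilipschitz_of_bound S (K := 1) fun x => ?_
      have h1 := hA.norm_le x.2
      rw [hS, NNReal.coe_one, one_mul]
      have h2 : ‖x‖ = max ‖x.1.1‖ ‖x.1.2‖ := rfl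
      rw [h2]
      exact max_le
        (abs_le_of_sq_le_sq' (by nlinarith [sq_nonneg ‖x.1.2‖]) (norm_nonneg _)).2
        (abs_le_of_sq_le_sq' (by nlinarith [sq_nonneg ‖x.1.1‖]) (norm_nonneg _)).2
    have huc : UniformContinuous S := by
      have : Continuous S := by
        show Continuous fun x : A => x.1.1 + x.1.2
        fun_prop
      exact uniformContinuous_addMonoidHom_of_continuous (f := S) this
    rw [LinearMap.coe_range]
    exact hanti.isClosed_range huc
  have htop : LinearMap.range S = ⊤ := by
    have : CompleteSpace (LinearMap.range S) := hcl.completeSpace_coe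
    rw [← Submodule.orthogonal_eq_bot_iff, Submodule.eq_bot_iff]
    intro g hg
    rw [Submodule.mem_orthogonal] at hg
    have hmem : (g, -g) ∈ A := by
      rw [hA.1.mem_iff]
      intro a b hab
      have := hg (a + b) ⟨⟨(a, b), hab⟩, rfl⟩
      rw [inner_add_left] at this
      simp only [inner_neg_right]
      linear_combination this
    have := hA.re_nonneg hmem
    simp only [inner_neg_right, inner_self_eq_norm_sq_to_K] at this
    have h3 : -(‖g‖ ^ 2) ≥ 0 := by
      have e : ((-((‖g‖ : ℂ) ^ 2))).re = -(‖g‖ ^ 2) := by norm_cast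
      simpa [e] using this
    have : ‖g‖ = 0 := by nlinarith [norm_nonneg g]
    simpa using this
  have : h ∈ LinearMap.range S := htop ▸ Submodule.mem_top
  obtain ⟨x, hx⟩ := this
  exact ⟨x.1, x.2, hx⟩

/-- A nonnegative selfadjoint relation is `{{B k, (1 - B) k}}` with `0 ≤ B ≤ 1`, where
`B = (I + A)⁻¹`. -/
theorem NonnegSA.exists_resolvent {A : LinRel H} (hA : A.NonnegSA) :
    ∃ B : H →L[ℂ] H, 0 ≤ B ∧ B ≤ 1 ∧ A = ofPair B (1 - B) := by
  choose x hxA hx using hA.exists_add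
  have huniq : ∀ y ∈ A, ∀ k, y.1 + y.2 = k → y.1 = (x k).1 := by
    intro y hy k hk
    have h := hA.norm_le (A.sub_mem hy (hxA k))
    have e : (y - x k).1 + (y - x k).2 = 0 := by
      have := hx k
      simp only [Prod.fst_sub, Prod.snd_sub]
      rw [← this] at hk
      rw [show y.1 - (x k).1 + (y.2 - (x k).2) = (y.1 + y.2) - ((x k).1 + (x k).2) by abel, hk,
        sub_self]
    rw [e, norm_zero] at h
    have : ‖(y - x k).1‖ = 0 := by
      nlinarith [norm_nonneg (y - x k).1, sq_nonneg ‖(y - x k).2‖]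
    simpa [sub_eq_zero] using this
  let B₀ : H →ₗ[ℂ] H :=
    { toFun := fun k => (x k).1
      map_add' := fun k l => by
        refine (huniq _ (A.add_mem (hxA k) (hxA l)) _ ?_).symm
        rw [Prod.fst_add, Prod.snd_add]
        nth_rewrite 3 [← hx k]
        nth_rewrite 3 [← hx l]
        abel
      map_smul' := fun c k => by
        refine (huniq _ (A.smul_mem c (hxA k)) _ ?_).symm
        rw [Prod.smul_fst, Prod.smul_snd, ← smul_add, hx] }
  let B : H →L[ℂ] H := B₀.mkContinuous 1 fun k => by
    have h := hA.norm_le (hxA k)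
    rw [hx] at h
    rw [one_mul]
    refine (abs_le_of_sq_le_sq' ?_ (norm_nonneg _)).2
    show ‖(x k).1‖ ^ 2 ≤ _
    nlinarith [sq_nonneg ‖(x k).2‖]
  have hB : ∀ k, B k = (x k).1 := fun k => rfl
  have hB' : ∀ k, k - B k = (x k).2 := fun k => by
    rw [hB]
    nth_rewrite 1 [← hx k]
    abel
  have hsymm : ∀ k l, ⟪B k, l⟫_ℂ = ⟪k, B l⟫_ℂ := by
    intro k l
    have h := (hA.1.mem_iff _).1 (hxA l) _ _ (hxA k)
    rw [← hB, ← hB', ← hB, ← hB'] at h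
    simp only [inner_sub_left, inner_sub_right] at h
    linear_combination -h
  have hpos : ∀ k, 0 ≤ (⟪B k, k - B k⟫_ℂ).re := by
    intro k
    rw [hB, ← hB]
    have := hA.re_nonneg (hxA k)
    rwa [← hB, ← hB'] at this
  have hBB : ∀ k, 0 ≤ (⟪B k, B k⟫_ℂ).re := fun k => inner_self_nonneg (𝕜 := ℂ)
  have hcc : ∀ k, 0 ≤ (⟪k - B k, k - B k⟫_ℂ).re := fun k => inner_self_nonneg (𝕜 := ℂ)
  refine ⟨B, ?_, ?_, ?_⟩
  · rw [ContinuousLinearMap.nonneg_iff_isPositive, ContinuousLinearMap.isPositive_def]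
    refine ⟨fun k l => hsymm k l, fun k => ?_⟩
    have h1 := hpos k
    rw [inner_sub_right, Complex.sub_re] at h1
    show 0 ≤ (⟪B k, k⟫_ℂ).re
    linarith [hBB k]
  · rw [ContinuousLinearMap.le_def, ContinuousLinearMap.isPositive_def]
    refine ⟨fun k l => ?_, fun k => ?_⟩
    · show ⟪k - B k, l⟫_ℂ = ⟪k, l - B l⟫_ℂ
      rw [inner_sub_left, inner_sub_right, hsymm]
    · show 0 ≤ (⟪k - B k, k⟫_ℂ).re
      have h1 := hpos k
      have h2 : (⟪k - B k, B k⟫_ℂ).re = (⟪B k, k - B k⟫_ℂ).re := by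
        rw [← inner_conj_symm]
        exact Complex.conj_re _
      have h3 : (⟪k - B k, k⟫_ℂ) = ⟪k - B k, B k⟫_ℂ + ⟪k - B k, k - B k⟫_ℂ := by
        rw [← inner_add_right]
        congr 1
        abel
      rw [h3, Complex.add_re, h2]
      linarith [hcc k]
  · ext y
    rw [mem_ofPair]
    constructor
    · intro hy
      refine ⟨y.1 + y.2, ?_, ?_⟩
      · rw [hB, ← huniq y hy _ rfl]
      · show (y.1 + y.2) - B (y.1 + y.2) = y.2
        rw [hB, ← huniq y hy _ rfl]
        abel
    · rintro ⟨k, h1, h2⟩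
      have : y = x k := Prod.ext (by rw [← h1, hB]) (by rw [← h2, ← hB']; rfl)
      rw [this]
      exact hxA k

theorem IsSqrt.exists {A : LinRel H} (hA : A.NonnegSA) : ∃ R, IsSqrt A R := by
  obtain ⟨B, h0, h1, hAB⟩ := hA.exists_resolvent
  have h1' : 0 ≤ 1 - B := sub_nonneg.2 h1
  set P := CFC.sqrt B with hP
  set Q := CFC.sqrt (1 - B) with hQ
  have hP0 : 0 ≤ P := CFC.sqrt_nonneg B
  have hQ0 : 0 ≤ Q := CFC.sqrt_nonneg (1 - B)
  have hPP : P * P = B := CFC.sqrt_mul_sqrt_self B h0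
  have hQQ : Q * Q = 1 - B := CFC.sqrt_mul_sqrt_self (1 - B) h1'
  have hcomm : Commute P Q := by
    have c1 : Commute B (1 - B) := (Commute.one_right B).sub_right (Commute.refl B)
    have c2 : Commute P (1 - B) := by
      rw [hP, CFC.sqrt]
      exact c1.cfcₙ_nnreal _
    have c3 : Commute Q P := by
      rw [hQ, CFC.sqrt]
      exact c2.symm.cfcₙ_nnreal _
    exact c3.symm
  have hsum : ∀ k, P (P k) + Q (Q k) = k := by
    intro k
    have : (P * P + Q * Q) k = k := by rw [hPP, hQQ]; simp
    simpa using this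
  have hPQ : ∀ k, P (Q k) = Q (P k) := fun k => by
    have := congrArg (fun T : H →L[ℂ] H => T k) hcomm.eq
    simpa using this
  have sP : ∀ k l, ⟪P k, l⟫_ℂ = ⟪k, P l⟫_ℂ :=
    ((ContinuousLinearMap.nonneg_iff_isPositive P).1 hP0).isSymmetric
  have sQ : ∀ k l, ⟪Q k, l⟫_ℂ = ⟪k, Q l⟫_ℂ :=
    ((ContinuousLinearMap.nonneg_iff_isPositive Q).1 hQ0).isSymmetric
  refine ⟨ofPair P Q, ⟨?_, ?_⟩, ?_⟩
  · show Submodule.adjoint (ofPair P Q) = ofPair P Q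
    ext y
    rw [Submodule.mem_adjoint_iff, mem_ofPair]
    constructor
    · intro h
      have hy : Q y.1 = P y.2 := by
        refine ext_inner_left ℂ fun k => ?_
        have := h (P k) (Q k) (mem_ofPair.2 ⟨k, rfl, rfl⟩)
        rw [sub_eq_zero, sQ, sP] at this
        exact this
      refine ⟨P y.1 + Q y.2, ?_, ?_⟩
      · rw [map_add, hPQ, ← hy, hsum]
      · rw [map_add, ← hPQ, hy, hsum]
    · rintro ⟨k, h1, h2⟩ a b hab
      obtain ⟨l, h3, h4⟩ := mem_ofPair.1 hab
      rw [← h1, ← h2, sub_eq_zero]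
      simp only at h3 h4
      rw [← h3, ← h4, sQ, sP, hPQ]
  · rintro y hy
    obtain ⟨k, h1, h2⟩ := mem_ofPair.1 hy
    rw [← h1, ← h2, sQ]
    have hPQ0 : 0 ≤ P * Q := hcomm.mul_nonneg hP0 hQ0
    have := ((ContinuousLinearMap.nonneg_iff_isPositive (P * Q)).1 hPQ0).inner_nonneg_right k
    rw [← hPQ]
    exact this
  · rw [hAB]
    ext y
    rw [mem_ofPair]
    constructor
    · rintro ⟨g, h1, h2⟩
      obtain ⟨f, h3, h4⟩ := mem_ofPair.1 h1
      obtain ⟨h, h5, h6⟩ := mem_ofPair.1 h2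
      simp only at h3 h4 h5 h6
      have hf : P (P f + Q h) = f := by rw [map_add, hPQ, h5, ← h4, hsum]
      have hh : Q (P f + Q h) = h := by rw [map_add, ← hPQ, h4, ← h5, hsum]
      refine ⟨P f + Q h, ?_, ?_⟩
      · rw [← hPP]
        show P (P (P f + Q h)) = y.1
        rw [hf, h3]
      · rw [← hQQ]
        show Q (Q (P f + Q h)) = y.2
        rw [hh, h6]
    · rintro ⟨k, h1, h2⟩
      refine ⟨Q (P k), mem_ofPair.2 ⟨P k, ?_, rfl⟩, mem_ofPair.2 ⟨Q k, hPQ k, ?_⟩⟩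
      · rw [← h1, ← hPP]; rfl
      · rw [← h2, ← hQQ]; rfl

theorem IsSqrt.unique {A R S : LinRel H} (hR : IsSqrt A R) (hS : IsSqrt A S) (hA : A.NonnegSA) :
    R = S := by
  obtain ⟨B, -, -, hAB⟩ := hA.exists_resolvent
  let b : ℝ → ℝ := fun x => x ^ 2 / (x ^ 2 + (1 - x) ^ 2)
  let g : ℝ → ℝ := fun y => √y / (√y + √(1 - y))
  have hd : ∀ x : ℝ, 0 < x ^ 2 + (1 - x) ^ 2 := fun x => by nlinarith [sq_nonneg (2 * x - 1)]
  have hbc : Continuous b := by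
    refine Continuous.div (by fun_prop) (by fun_prop) fun x => (hd x).ne'
  suffices key : ∀ R, IsSqrt A R → R = ofPair (cfc g B) (1 - cfc g B) by rw [key R hR, key S hS]
  intro R hR
  obtain ⟨C, h0, h1, hRC⟩ := hR.1.exists_resolvent
  have hC : IsSelfAdjoint C := .of_nonneg h0
  have hmem : ∀ k, (C (C k), (1 - C) ((1 - C) k)) ∈ A := fun k => by
    rw [← hR.2, hRC]
    refine ⟨(1 - C) (C k), mem_ofPair.2 ⟨C k, rfl, rfl⟩, mem_ofPair.2 ⟨(1 - C) k, ?_, rfl⟩⟩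
    simp
  have hBD : B * (C ^ 2 + (1 - C) ^ 2) = C ^ 2 := by
    ext k
    have := hmem k
    rw [hAB] at this
    obtain ⟨l, h2, h3⟩ := mem_ofPair.1 this
    have hl : (C ^ 2 + (1 - C) ^ 2 : H →L[ℂ] H) k = l := by
      show (C ^ 2) k + ((1 - C) ^ 2 : H →L[ℂ] H) k = l
      rw [sq, sq]
      show C (C k) + (1 - C) ((1 - C) k) = l
      simp only at h2 h3
      rw [← h2, ← h3]
      simp
    show B ((C ^ 2 + (1 - C) ^ 2 : H →L[ℂ] H) k) = _
    rw [hl, h2, sq]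
    rfl
  have hD : cfc (fun x : ℝ => x ^ 2 + (1 - x) ^ 2) C = C ^ 2 + (1 - C) ^ 2 := by
    rw [cfc_add .., cfc_pow .., cfc_pow .., cfc_sub .., cfc_id' ℝ C, cfc_const_one ℝ C]
  have hinvc : Continuous fun x : ℝ => 1 / (x ^ 2 + (1 - x) ^ 2) :=
    Continuous.div (by fun_prop) (by fun_prop) fun x => (hd x).ne'
  have hbB : cfc b C = B := by
    have e1 : cfc b C * cfc (fun x : ℝ => x ^ 2 + (1 - x) ^ 2) C = C ^ 2 := by
      rw [← cfc_mul b _ C hbc.continuousOn (by fun_prop)]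
      rw [← cfc_pow_id (R := ℝ) C 2]
      refine cfc_congr fun x _ => ?_
      exact div_mul_cancel₀ _ (hd x).ne'
    have e2 : cfc (fun x : ℝ => x ^ 2 + (1 - x) ^ 2) C *
        cfc (fun x : ℝ => 1 / (x ^ 2 + (1 - x) ^ 2)) C = 1 := by
      rw [← cfc_mul _ _ C (by fun_prop) hinvc.continuousOn, ← cfc_const_one ℝ C]
      refine cfc_congr fun x _ => ?_
      exact mul_one_div_cancel (hd x).ne'
    calc cfc b C = cfc b C * (cfc (fun x : ℝ => x ^ 2 + (1 - x) ^ 2) C *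
          cfc (fun x : ℝ => 1 / (x ^ 2 + (1 - x) ^ 2)) C) := by rw [e2, mul_one]
      _ = B * (cfc (fun x : ℝ => x ^ 2 + (1 - x) ^ 2) C *
          cfc (fun x : ℝ => 1 / (x ^ 2 + (1 - x) ^ 2)) C) := by
            rw [← mul_assoc, e1, ← hBD, ← hD, mul_assoc]
      _ = B := by rw [e2, mul_one]
  have hspec : ∀ x ∈ spectrum ℝ C, 0 ≤ x ∧ x ≤ 1 := fun x hx =>
    ⟨spectrum_nonneg_of_nonneg h0 hx, by
      have := (le_algebraMap_iff_spectrum_le (R := ℝ) (r := 1) (a := C)).1 (by simpa using h1) x hx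
      exact this⟩
  have hgc : Continuous g := by
    refine Continuous.div (by fun_prop) (by fun_prop) fun y => ?_
    rcases le_or_gt y (1 / 2) with h | h
    · have := Real.sqrt_pos.2 (show (0 : ℝ) < 1 - y by linarith)
      have := Real.sqrt_nonneg y
      positivity
    · have := Real.sqrt_pos.2 (show (0 : ℝ) < y by linarith)
      have := Real.sqrt_nonneg (1 - y)
      positivity
  have hgB : cfc g B = C := by
    rw [← hbB, ← cfc_comp g b C hC hgc.continuousOn hbc.continuousOn]
    nth_rewrite 2 [← cfc_id ℝ C]
    refine cfc_congr fun x hx => ?_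
    obtain ⟨hx0, hx1⟩ := hspec x hx
    have e1 : √(b x) = x / √(x ^ 2 + (1 - x) ^ 2) := by
      rw [Real.sqrt_div (sq_nonneg x), Real.sqrt_sq hx0]
    have e2 : √(1 - b x) = (1 - x) / √(x ^ 2 + (1 - x) ^ 2) := by
      rw [← Real.sqrt_sq (show 0 ≤ 1 - x by linarith), ← Real.sqrt_div (sq_nonneg _),
        Real.sqrt_sq (show 0 ≤ 1 - x by linarith)]
      congr 1
      have := (hd x).ne'
      simp only [b]
      field_simp
      ring
    have h3 := Real.sqrt_pos.2 (hd x)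
    show √(b x) / (√(b x) + √(1 - b x)) = x
    rw [e1, e2]
    field_simp
    ring
  rw [hgB, hRC]

end Sqrt

section Forms

variable {H : Type*} [NormedAddCommGroup H] [InnerProductSpace ℂ H]

open Classical in
/-- The square root `A^{1/2}` of a nonnegative selfadjoint relation `A`, that is, its unique
nonnegative selfadjoint square root (see `existsUnique_sqrt`). -/
def sqrt (A : LinRel H) : LinRel H :=
  if h : ∃ R, IsSqrt A R then h.choose else ⊥

theorem existsUnique_sqrt [CompleteSpace H] {A : LinRel H} (hA : A.NonnegSA) :
    IsSqrt A A.sqrt ∧ ∀ R, IsSqrt A R → R = A.sqrt := by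
  have h := IsSqrt.exists hA
  have h1 : IsSqrt A A.sqrt := by
    rw [sqrt, dif_pos h]
    exact h.choose_spec
  exact ⟨h1, fun R hR => hR.unique h1 hA⟩

/-- The operator `A_o^{1/2}`, the operator part of `A^{1/2}`. -/
def sqrtOp (A : LinRel H) : H →ₗ.[ℂ] H := A.sqrt.opPart

/-- The order `A ≤ B` of nonnegative selfadjoint relations: `dom B_o^{1/2} ⊆ dom A_o^{1/2}` and
`‖A_o^{1/2} f‖ ≤ ‖B_o^{1/2} f‖` for `f ∈ dom B_o^{1/2}`. -/
def Le (A B : LinRel H) : Prop :=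
  ∃ h : B.sqrtOp.domain ≤ A.sqrtOp.domain,
    ∀ f : B.sqrtOp.domain, ‖A.sqrtOp ⟨f, h f.2⟩‖ ≤ ‖B.sqrtOp f‖

/-- The set `Ξ(A, L)` of the nonnegative selfadjoint relations `B ≤ A` with `ran B ⊆ L`. -/
def Xi (A : LinRel H) (L : Submodule ℂ H) : Set (LinRel H) :=
  {B | B.NonnegSA ∧ Le B A ∧ B.ran ≤ L}

end Forms

end LinRel

/-- A sesquilinear form in `H` with a linear domain; as for the inner product of `H` in Mathlib,
it is conjugate-linear in the first and linear in the second argument. -/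
structure SesqForm (H : Type*) [NormedAddCommGroup H] [InnerProductSpace ℂ H] where
  domain : Submodule ℂ H
  form : domain →ₗ⋆[ℂ] domain →ₗ[ℂ] ℂ

namespace SesqForm

variable {H : Type*} [NormedAddCommGroup H] [InnerProductSpace ℂ H]

/-- The form is nonnegative. -/
def Nonneg (a : SesqForm H) : Prop := ∀ f, 0 ≤ a.form f f

/-- The form is closed: if `φ n ∈ dom a`, `φ n → f` in `H` and `a[φ n - φ m] → 0`, then `f ∈ dom a`
and `a[φ n - f] → 0`. -/
def Closed (a : SesqForm H) : Prop :=
  ∀ (φ : ℕ → a.domain) (f : H), Tendsto (fun n => (φ n : H)) atTop (𝓝 f) →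
    Tendsto (fun p : ℕ × ℕ => a.form (φ p.1 - φ p.2) (φ p.1 - φ p.2)) atTop (𝓝 0) →
    ∃ h : f ∈ a.domain,
      Tendsto (fun n => a.form (φ n - ⟨f, h⟩) (φ n - ⟨f, h⟩)) atTop (𝓝 0)

/-- The closed nonnegative form `a` is associated with the relation `A` (first representation
theorem): `dom A ⊆ dom a`, and `a` of `f`, `ψ` is the inner product of `f'` and `ψ` for
`{f, f'} ∈ A` and `ψ ∈ dom a`. -/
def IsAssociated (a : SesqForm H) (A : LinRel H) : Prop :=
  a.Nonneg ∧ a.Closed ∧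
    ∀ x ∈ A, ∃ h : x.1 ∈ a.domain, ∀ ψ : a.domain, a.form ψ ⟨x.1, h⟩ = ⟪(ψ : H), x.2⟫_ℂ

/-- The form `A[·,·]` of a nonnegative selfadjoint relation `A`: its domain `D[A]` is
`dom A_o^{1/2}` and its values are the inner products of `A_o^{1/2} f` and `A_o^{1/2} g`. -/
def ofRel (A : LinRel H) : SesqForm H where
  domain := A.sqrtOp.domain
  form := LinearMap.mk₂'ₛₗ (starRingEnd ℂ) (RingHom.id ℂ)
    (fun f g => ⟪A.sqrtOp f, A.sqrtOp g⟫_ℂ)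
    (fun f g k => by rw [LinearPMap.map_add, inner_add_left])
    (fun c f g => by rw [LinearPMap.map_smul, inner_smul_left, smul_eq_mul])
    (fun f g k => by rw [LinearPMap.map_add, inner_add_right])
    (fun c f g => by rw [LinearPMap.map_smul, inner_smul_right, smul_eq_mul, RingHom.id_apply])

/-- The restriction of a form to `dom a ∩ L`, as a form in the space `L`. -/
def restrict (a : SesqForm H) (L : Submodule ℂ H) : SesqForm L where
  domain := a.domain.comap L.subtype
  form := LinearMap.mk₂'ₛₗ (starRingEnd ℂ) (RingHom.id ℂ)
    (fun f g => a.form ⟨(f : L), f.2⟩ ⟨(g : L), g.2⟩)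
    (fun f g k => LinearMap.map_add₂ a.form ⟨(f : L), f.2⟩ ⟨(g : L), g.2⟩ ⟨(k : L), k.2⟩)
    (fun c f g => LinearMap.map_smulₛₗ₂ a.form c ⟨(f : L), f.2⟩ ⟨(g : L), g.2⟩)
    (fun f g k => map_add (a.form ⟨(f : L), f.2⟩) ⟨(g : L), g.2⟩ ⟨(k : L), k.2⟩)
    (fun c f g => map_smul (a.form ⟨(f : L), f.2⟩) c ⟨(g : L), g.2⟩)

end SesqForm

/-- `X` is the shorted operator `S_L` of the bounded nonnegative operator `S` to the subspace `L`:
the greatest element, in the usual order, of the set of the bounded nonnegative selfadjoint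
operators that are `≤ S` and have range in `L`. -/
def IsShortedOp {H : Type*} [NormedAddCommGroup H] [InnerProductSpace ℂ H]
    (S : H →L[ℂ] H) (L : Submodule ℂ H) (X : H →L[ℂ] H) : Prop :=
  IsGreatest {Y : H →L[ℂ] H | 0 ≤ Y ∧ Y ≤ S ∧ (Y : H →ₗ[ℂ] H).range ≤ L} X

end

/-! Every nonnegative selfadjoint relation is `{{P² k, Q² k}}` with commuting `P, Q ≥ 0` and `P² +
Q² = 1`, where `P² = (I + A)⁻¹`; its square root is then `{{P k, Q k}}`. The assignment `A ↦ Q² = I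
- (I + A)⁻¹` turns relations into operators between `0` and `1`, preserves and reflects the order
(`IsSqrtPair.le_iff`), and `A` and `Q²` have the same range. So `Ξ(A, L)` corresponds to the
operators `Y` with `0 ≤ Y ≤ Q²` and `ran Y ⊆ L`, and the problem becomes Krein's: the greatest such
`Y` is the shorted operator `X = Q Π Q`, with `Π` the projection onto `M = Q⁻¹(L)`
(`isShortedOp_shorted`). Hence `A_L = {{(1 - X) k, X k}}`.

All other claims are read off from `X`. The Cayley transform of `A` is `1 - 2Q²`, and shorting is
homogeneous, which gives the formula in (3). Since `X = (QΠ)(QΠ)†`, Douglas' range lemma gives `ran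
X^{1/2} = Q(M) = ran Q ∩ L`, which is (2). As `X` maps into `L` and kills `Lᗮ`, the subspace `L`
reduces `A_L`; the form in (1) is a computation with `P² = 1 - Q²`. The multivalued part of `A_L` is
`ker (1 - X) = ker P ∩ L`, which is (4). For (5), `𝔐 = P(M)`, and `A_L` is a bounded operator
exactly when `P` is bounded below on `M`, that is, injective there with closed range; by `‖P m‖² +
‖Q m‖² = ‖m‖²` and duality this amounts to `‖X‖ < 1`. -/

/-! ### Douglas' range lemma. -/

section Douglas

variable {H : Type*} [NormedAddCommGroup H] [InnerProductSpace ℂ H]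

theorem ContinuousLinearMap.inner_map_left_of_nonneg {T : H →L[ℂ] H} [CompleteSpace H]
    (hT : 0 ≤ T) (k l : H) : ⟪T k, l⟫_ℂ = ⟪k, T l⟫_ℂ :=
  ((ContinuousLinearMap.nonneg_iff_isPositive T).1 hT).isSymmetric k l

theorem ContinuousLinearMap.re_inner_le_of_le {S T : H →L[ℂ] H} [CompleteSpace H]
    (h : S ≤ T) (k : H) : (⟪S k, k⟫_ℂ).re ≤ (⟪T k, k⟫_ℂ).re := by
  rw [ContinuousLinearMap.le_def] at h
  have := h.re_inner_nonneg_left k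
  simp only [sub_apply, inner_sub_left, map_sub, RCLike.re_to_complex] at this
  linarith

/-- A vector that is dominated by `T†` lies in the range of `T`, with a bound on a preimage. -/
theorem ContinuousLinearMap.exists_apply_eq_of_norm_inner_le [CompleteSpace H] (T : H →L[ℂ] H)
    (y : H) {c : ℝ} (hc : 0 ≤ c)
    (h : ∀ f, ‖⟪y, f⟫_ℂ‖ ≤ c * ‖ContinuousLinearMap.adjoint T f‖) :
    ∃ z, ‖z‖ ≤ c ∧ T z = y := by
  let A : H →ₗ[ℂ] H := (ContinuousLinearMap.adjoint T : H →L[ℂ] H)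
  -- A linear section of `T†` defines the functional `T† f ↦ ⟪y, f⟫` on `ran T†`; the bound `h`
  -- makes it continuous and, applied to a difference of two preimages, independent of the section.
  -- Hahn–Banach and Riesz then produce `z`.
  obtain ⟨σ, hσ⟩ := A.rangeRestrict.exists_rightInverse_of_surjective A.range_rangeRestrict
  have hσ' : ∀ g : LinearMap.range A, A (σ g) = g := fun g =>
    congrArg Subtype.val (LinearMap.congr_fun hσ g)
  let φ : StrongDual ℂ (LinearMap.range A) :=
    ((innerSL ℂ y : H →ₗ[ℂ] ℂ).comp σ).mkContinuous c fun g => by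
      have := h (σ g)
      rw [show ContinuousLinearMap.adjoint T (σ g) = g from hσ' g] at this
      exact this
  have hφ : ∀ f, φ ⟨A f, f, rfl⟩ = ⟪y, f⟫_ℂ := fun f => by
    have h1 := h (σ ⟨A f, f, rfl⟩ - f)
    rw [map_sub, show ContinuousLinearMap.adjoint T (σ ⟨A f, f, rfl⟩) = A f from hσ' _,
      show A f - ContinuousLinearMap.adjoint T f = 0 from sub_self _, norm_zero, mul_zero,
      norm_le_zero_iff, inner_sub_right, sub_eq_zero] at h1
    exact h1
  obtain ⟨ψ, hψ, hψn⟩ := exists_extension_norm_eq _ φ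
  refine ⟨(InnerProductSpace.toDual ℂ H).symm ψ, ?_, ?_⟩
  · rw [LinearIsometryEquiv.norm_map, hψn]
    exact LinearMap.mkContinuous_norm_le _ hc _
  · refine ext_inner_right ℂ fun f => ?_
    rw [← ContinuousLinearMap.adjoint_inner_right, InnerProductSpace.toDual_symm_apply]
    exact (hψ ⟨A f, f, rfl⟩).trans (hφ f)

/-- The range of `T` depends only on `‖T† ·‖`. -/
theorem ContinuousLinearMap.range_le_range_of_norm_adjoint_le [CompleteSpace H] {S T : H →L[ℂ] H}
    (h : ∀ f, ‖ContinuousLinearMap.adjoint S f‖ ≤ ‖ContinuousLinearMap.adjoint T f‖) (k : H) :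
    ∃ z, ‖z‖ ≤ ‖k‖ ∧ T z = S k := by
  refine T.exists_apply_eq_of_norm_inner_le _ (norm_nonneg k) fun f => ?_
  rw [← ContinuousLinearMap.adjoint_inner_right]
  exact (norm_inner_le_norm _ _).trans (mul_le_mul_of_nonneg_left (h f) (norm_nonneg _))

end Douglas

/-! ### Parametrisation of nonnegative selfadjoint relations by pairs of operators. -/

namespace LinRel

variable {H : Type*} [NormedAddCommGroup H] [InnerProductSpace ℂ H]

theorem eq_zero_of_mem_inf_mul_orthogonal (A : LinRel H) :
    ∀ x ∈ A ⊓ (⊤ : Submodule ℂ H).prod A.mulᗮ, x.1 = 0 → x.2 = 0 := by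
  rintro ⟨a, b⟩ hx rfl
  have h2 : b ∈ A.mulᗮ := hx.2.2
  exact inner_self_eq_zero.1 ((Submodule.mem_orthogonal _ _).1 h2 b hx.1)

theorem graph_opPart (A : LinRel H) :
    A.opPart.graph = A ⊓ (⊤ : Submodule ℂ H).prod A.mulᗮ :=
  Submodule.toLinearPMap_graph_eq _ A.eq_zero_of_mem_inf_mul_orthogonal

/-- Commuting nonnegative operators with `P² + Q² = 1`. The nonnegative selfadjoint relations are
the `{{P² k, Q² k}}`, with square root `{{P k, Q k}}`. -/
structure IsSqrtPair (P Q : H →L[ℂ] H) : Prop where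
  fst_nonneg : 0 ≤ P
  snd_nonneg : 0 ≤ Q
  comm : Commute P Q
  sum : P * P + Q * Q = 1

namespace IsSqrtPair

variable {P Q : H →L[ℂ] H} (h : IsSqrtPair P Q)
include h

theorem symm : IsSqrtPair Q P :=
  ⟨h.snd_nonneg, h.fst_nonneg, h.comm.symm, by rw [add_comm, h.sum]⟩

theorem apply_comm (k : H) : P (Q k) = Q (P k) :=
  congrArg (fun T : H →L[ℂ] H => T k) h.comm.eq

theorem apply_sum (k : H) : P (P k) + Q (Q k) = k :=
  congrArg (fun T : H →L[ℂ] H => T k) h.sum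

theorem fst_mul_eq : P * P = 1 - Q * Q := by rw [← h.sum, add_sub_cancel_right]

variable [CompleteSpace H]

theorem inner_fst (k l : H) : ⟪P k, l⟫_ℂ = ⟪k, P l⟫_ℂ :=
  ContinuousLinearMap.inner_map_left_of_nonneg h.fst_nonneg k l

theorem inner_snd (k l : H) : ⟪Q k, l⟫_ℂ = ⟪k, Q l⟫_ℂ := h.symm.inner_fst k l

theorem norm_sq_add (k : H) : ‖P k‖ ^ 2 + ‖Q k‖ ^ 2 = ‖k‖ ^ 2 := by
  have e : ⟪P k, P k⟫_ℂ + ⟪Q k, Q k⟫_ℂ = ⟪k, k⟫_ℂ := by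
    rw [h.inner_fst, h.inner_snd, ← inner_add_right, h.apply_sum]
  simp only [inner_self_eq_norm_sq_to_K] at e
  exact_mod_cast e

-- From `P k = 0` follows `Q² k = k`, so `Q` sends `Q k - k` to its negative; positivity of `Q`
-- forces that vector to vanish.
omit [CompleteSpace H] in
theorem snd_eq_of_fst_eq_zero {k : H} (hk : P k = 0) : Q k = k := by
  have h1 : Q (Q k) = k := by simpa [hk] using h.apply_sum k
  have h2 := ((ContinuousLinearMap.nonneg_iff_isPositive Q).1 h.snd_nonneg).re_inner_nonneg_left
    (Q k - k)
  rw [map_sub, h1, ← neg_sub (Q k) k, inner_neg_left, inner_self_eq_norm_sq_to_K] at h2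
  have h3 : 0 ≤ -(‖Q k - k‖ ^ 2) := by
    have e : ((-((‖Q k - k‖ : ℂ) ^ 2))).re = -(‖Q k - k‖ ^ 2) := by norm_cast
    simpa [e] using h2
  have : ‖Q k - k‖ = 0 := by nlinarith [norm_nonneg (Q k - k)]
  exact sub_eq_zero.1 (norm_eq_zero.1 this)

theorem fst_eq_zero_iff {k : H} : P (P k) = 0 ↔ P k = 0 := by
  refine ⟨fun hk => ?_, fun hk => by rw [hk, map_zero]⟩
  have : ⟪P k, P k⟫_ℂ = 0 := by rw [h.inner_fst, hk, inner_zero_right]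
  exact inner_self_eq_zero.1 this

end IsSqrtPair

variable [CompleteSpace H]

/-- Every value of `P` is attained at a vector orthogonal to the kernel, without increasing the
norm. -/
theorem exists_mem_orthogonal_ker (P : H →L[ℂ] H) (k : H) :
    ∃ l ∈ ((P : H →ₗ[ℂ] H).ker)ᗮ, P l = P k ∧ ‖l‖ ≤ ‖k‖ := by
  have hcl : IsClosed (((P : H →ₗ[ℂ] H).ker : Submodule ℂ H) : Set H) := P.isClosed_ker
  have : CompleteSpace (P : H →ₗ[ℂ] H).ker := hcl.completeSpace_coe
  set K := (P : H →ₗ[ℂ] H).ker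
  have hmem : K.starProjection k ∈ K := K.starProjection_apply_mem k
  refine ⟨k - K.starProjection k, Submodule.sub_starProjection_mem_orthogonal k, ?_, ?_⟩
  · rw [map_sub, show P (K.starProjection k) = 0 from hmem, sub_zero]
  · have e : k - K.starProjection k = Kᗮ.starProjection k := by
      rw [Submodule.starProjection_orthogonal_val]
    rw [e]
    exact (ContinuousLinearMap.le_of_opNorm_le _ (Submodule.starProjection_norm_le _) k).trans
      (by rw [one_mul])

section SelfAdj

/-- The identity `U P + V Q = 1` is a Bézout relation. A pair `y` in the adjoint satisfies `Q y.1 =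
P y.2`, and then `U y.1 + V y.2` is a parameter for it. The cases used are `U = V = 1` for `(1 - X,
X)` and `U = P`, `V = Q` for a square root pair. -/
theorem nonnegSA_ofPair {P Q U V : H →L[ℂ] H} (hP : 0 ≤ P) (hQ : 0 ≤ Q) (hPQ : Commute P Q)
    (hUP : Commute U P) (hUQ : Commute U Q) (hVP : Commute V P) (hVQ : Commute V Q)
    (hUV : U * P + V * Q = 1) : (ofPair P Q).NonnegSA := by
  have ap : ∀ {S T : H →L[ℂ] H}, Commute S T → ∀ k, S (T k) = T (S k) := fun c k =>
    congrArg (fun T : H →L[ℂ] H => T k) c.eq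
  have hsum : ∀ k, U (P k) + V (Q k) = k := fun k =>
    congrArg (fun T : H →L[ℂ] H => T k) hUV
  have sP := ContinuousLinearMap.inner_map_left_of_nonneg hP
  have sQ := ContinuousLinearMap.inner_map_left_of_nonneg hQ
  refine ⟨?_, ?_⟩
  · show Submodule.adjoint (ofPair P Q) = ofPair P Q
    ext y
    rw [Submodule.mem_adjoint_iff, mem_ofPair]
    constructor
    · intro h
      have hy : Q y.1 = P y.2 := by
        refine ext_inner_left ℂ fun k => ?_
        have := h (P k) (Q k) (mem_ofPair.2 ⟨k, rfl, rfl⟩)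
        rwa [sub_eq_zero, sQ, sP] at this
      refine ⟨U y.1 + V y.2, ?_, ?_⟩
      · rw [map_add, ← ap hUP, ← ap hVP, ← hy, hsum]
      · rw [map_add, ← ap hUQ, ← ap hVQ, hy, hsum]
    · rintro ⟨k, h1, h2⟩ a b hab
      obtain ⟨l, h3, h4⟩ := mem_ofPair.1 hab
      simp only at h3 h4
      rw [← h1, ← h2, sub_eq_zero, ← h3, ← h4, sQ, sP, ap hPQ]
  · rintro y hy
    obtain ⟨k, h1, h2⟩ := mem_ofPair.1 hy
    rw [← h1, ← h2, sQ, ← ap hPQ]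
    exact ((ContinuousLinearMap.nonneg_iff_isPositive (P * Q)).1
      (hPQ.mul_nonneg hP hQ)).inner_nonneg_right k

theorem nonnegSA_ofPair_one_sub {X : H →L[ℂ] H} (h0 : 0 ≤ X) (h1 : X ≤ 1) :
    (ofPair (1 - X) X).NonnegSA :=
  nonnegSA_ofPair (U := 1) (V := 1) (sub_nonneg.2 h1) h0
    ((Commute.one_left X).sub_left (Commute.refl X)) (.one_left _) (.one_left _) (.one_left _)
    (.one_left _) (by simp)

theorem exists_isSqrtPair {X : H →L[ℂ] H} (h0 : 0 ≤ X) (h1 : X ≤ 1) :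
    ∃ P Q, IsSqrtPair P Q ∧ P * P = 1 - X ∧ Q * Q = X := by
  have h1' : 0 ≤ 1 - X := sub_nonneg.2 h1
  have hPP := CFC.sqrt_mul_sqrt_self (1 - X) h1'
  have hQQ := CFC.sqrt_mul_sqrt_self X h0
  refine ⟨CFC.sqrt (1 - X), CFC.sqrt X,
    ⟨CFC.sqrt_nonneg _, CFC.sqrt_nonneg _, ?_, by rw [hPP, hQQ, sub_add_cancel]⟩, hPP, hQQ⟩
  -- Both roots are continuous functions of operators commuting with each other, so commutation
  -- passes to one root at a time.
  have c1 : Commute X (1 - X) := (Commute.one_right X).sub_right (Commute.refl X)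
  have c2 : Commute (CFC.sqrt X) (1 - X) := by
    nth_rewrite 1 [CFC.sqrt]
    exact c1.cfcₙ_nnreal _
  have c3 : Commute (CFC.sqrt (1 - X)) (CFC.sqrt X) := by
    nth_rewrite 1 [CFC.sqrt]
    exact c2.symm.cfcₙ_nnreal _
  exact c3

theorem NonnegSA.exists_isSqrtPair {A : LinRel H} (hA : A.NonnegSA) :
    ∃ P Q, IsSqrtPair P Q ∧ A = ofPair (P * P) (Q * Q) := by
  obtain ⟨B, h0, h1, hB⟩ := hA.exists_resolvent
  obtain ⟨P, Q, h, hP, hQ⟩ := LinRel.exists_isSqrtPair (sub_nonneg.2 h1) (sub_le_self 1 h0)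
  exact ⟨P, Q, h, by rw [hP, hQ, hB, sub_sub_cancel]⟩

end SelfAdj

namespace IsSqrtPair

variable {P Q : H →L[ℂ] H} (h : IsSqrtPair P Q)
include h

theorem nonnegSA : (ofPair P Q).NonnegSA :=
  nonnegSA_ofPair h.fst_nonneg h.snd_nonneg h.comm (.refl P) h.comm h.comm.symm (.refl Q) h.sum

theorem snd_mul_le : Q * Q ≤ 1 := by
  rw [← h.sum, le_add_iff_nonneg_left, ContinuousLinearMap.nonneg_iff_isPositive,
    ContinuousLinearMap.isPositive_def]
  refine ⟨fun k l => ?_, fun k => ?_⟩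
  · show ⟪P (P k), l⟫_ℂ = ⟪k, P (P l)⟫_ℂ
    rw [h.inner_fst, h.inner_fst]
  · show 0 ≤ RCLike.re ⟪P (P k), k⟫_ℂ
    rw [h.inner_fst]
    exact inner_self_nonneg

theorem snd_mul_nonneg : 0 ≤ Q * Q := by
  have := h.symm.snd_mul_le
  rwa [← h.sum, le_add_iff_nonneg_right] at this

theorem nonnegSA_mul : (ofPair (P * P) (Q * Q)).NonnegSA := by
  rw [h.fst_mul_eq]
  exact nonnegSA_ofPair_one_sub h.snd_mul_nonneg h.snd_mul_le

theorem isSqrt : IsSqrt (ofPair (P * P) (Q * Q)) (ofPair P Q) := by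
  refine ⟨h.nonnegSA, ?_⟩
  ext y
  rw [mem_ofPair]
  constructor
  · rintro ⟨g, h1, h2⟩
    obtain ⟨f, h3, h4⟩ := mem_ofPair.1 h1
    obtain ⟨l, h5, h6⟩ := mem_ofPair.1 h2
    simp only at h3 h4 h5 h6
    -- The composition supplies two parameters `f`, `l` linked by `Q f = P l`; the single vector `P
    -- f + Q l` has image `f` under `P` and `l` under `Q`.
    have hf : P (P f + Q l) = f := by rw [map_add, h.apply_comm, h5, ← h4, h.apply_sum]
    have hl : Q (P f + Q l) = l := by rw [map_add, ← h.apply_comm, h4, ← h5, h.apply_sum]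
    exact ⟨P f + Q l, (congrArg P hf).trans h3, (congrArg Q hl).trans h6⟩
  · rintro ⟨k, h1, h2⟩
    exact ⟨Q (P k), mem_ofPair.2 ⟨P k, h1, rfl⟩, mem_ofPair.2 ⟨Q k, h.apply_comm k, h2⟩⟩

theorem sqrt_eq : (ofPair (P * P) (Q * Q)).sqrt = ofPair P Q :=
  ((existsUnique_sqrt h.nonnegSA_mul).2 _ h.isSqrt).symm

omit [CompleteSpace H] in
theorem mem_mul_iff {y : H} : y ∈ (ofPair P Q).mul ↔ P y = 0 := by
  constructor
  · intro hy
    obtain ⟨k, h1, h2⟩ := mem_ofPair.1 (show ((0 : H), y) ∈ ofPair P Q from hy)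
    simp only at h1 h2
    rw [← h2, h.snd_eq_of_fst_eq_zero h1, h1]
  · intro hy
    exact mem_ofPair.2 ⟨y, hy, h.snd_eq_of_fst_eq_zero hy⟩

omit [CompleteSpace H] in
theorem mul_eq_ker : (ofPair P Q).mul = (P : H →ₗ[ℂ] H).ker := by
  ext y
  exact h.mem_mul_iff

theorem snd_mem_orthogonal {k : H} (hk : k ∈ ((P : H →ₗ[ℂ] H).ker)ᗮ) :
    Q k ∈ ((P : H →ₗ[ℂ] H).ker)ᗮ := by
  rw [Submodule.mem_orthogonal] at hk ⊢
  intro u hu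
  rw [← h.inner_snd, h.snd_eq_of_fst_eq_zero hu]
  exact hk u hu

theorem mem_graph_opPart {k : H} (hk : k ∈ ((P : H →ₗ[ℂ] H).ker)ᗮ) :
    (P k, Q k) ∈ (ofPair P Q).opPart.graph := by
  rw [graph_opPart, h.mul_eq_ker]
  exact ⟨mem_ofPair.2 ⟨k, rfl, rfl⟩, trivial, h.snd_mem_orthogonal hk⟩

/-- The operator part sends `P k` to `Q k` only for `k ⟂ ker P`, since `mul` of the pair relation is
`ker P` and `Q` is the identity there; an arbitrary parameter is first moved to that complement. -/
theorem mem_domain_opPart (k : H) : P k ∈ (ofPair P Q).opPart.domain := by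
  obtain ⟨l, hl, e, -⟩ := exists_mem_orthogonal_ker P k
  rw [← e]
  exact LinearPMap.mem_domain_of_mem_graph (h.mem_graph_opPart hl)

theorem opPart_apply {k f : H} (hk : k ∈ ((P : H →ₗ[ℂ] H).ker)ᗮ) (hf : P k = f)
    (hd : f ∈ (ofPair P Q).opPart.domain) : (ofPair P Q).opPart ⟨f, hd⟩ = Q k := by
  subst hf
  exact LinearPMap.mem_graph_snd_inj _ (LinearPMap.mem_graph _ ⟨P k, hd⟩) (h.mem_graph_opPart hk) rfl

theorem mem_domain_opPart_iff {f : H} : f ∈ (ofPair P Q).opPart.domain ↔ ∃ k, P k = f := by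
  constructor
  · intro hf
    have := LinearPMap.mem_graph _ ⟨f, hf⟩
    rw [graph_opPart] at this
    obtain ⟨k, hk, -⟩ := mem_ofPair.1 this.1
    exact ⟨k, hk⟩
  · rintro ⟨k, rfl⟩
    exact h.mem_domain_opPart k

theorem sqrtOp_eq : (ofPair (P * P) (Q * Q)).sqrtOp = (ofPair P Q).opPart := by
  rw [sqrtOp, h.sqrt_eq]

end IsSqrtPair

end LinRel

namespace LinRel

variable {H : Type*} [NormedAddCommGroup H] [InnerProductSpace ℂ H] [CompleteSpace H]

/-! ### The order of relations as an operator order. -/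

section Order

theorem mul_self_le_mul_self_iff {S T : H →L[ℂ] H} (hS : 0 ≤ S) (hT : 0 ≤ T) :
    S * S ≤ T * T ↔ ∀ k, ‖S k‖ ≤ ‖T k‖ := by
  have sS := ContinuousLinearMap.inner_map_left_of_nonneg hS
  have sT := ContinuousLinearMap.inner_map_left_of_nonneg hT
  have e : ∀ {R : H →L[ℂ] H}, (∀ k l, ⟪R k, l⟫_ℂ = ⟪k, R l⟫_ℂ) → ∀ k,
      (⟪(R * R) k, k⟫_ℂ).re = ‖R k‖ ^ 2 := fun {R} hR k => by
    show (⟪R (R k), k⟫_ℂ).re = _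
    rw [hR]
    exact inner_self_eq_norm_sq (𝕜 := ℂ) _
  constructor
  · intro h k
    have := ContinuousLinearMap.re_inner_le_of_le h k
    rw [e sS, e sT] at this
    exact (abs_le_of_sq_le_sq' this (norm_nonneg _)).2
  · intro h
    rw [ContinuousLinearMap.le_def, ContinuousLinearMap.isPositive_def]
    refine ⟨fun k l => ?_, fun k => ?_⟩
    · show ⟪T (T k) - S (S k), l⟫_ℂ = ⟪k, T (T l) - S (S l)⟫_ℂ
      rw [inner_sub_left, inner_sub_right, sT, sT, sS, sS]
    · show 0 ≤ (⟪(T * T) k - (S * S) k, k⟫_ℂ).re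
      rw [inner_sub_left, Complex.sub_re, e sS, e sT, sub_nonneg]
      exact pow_le_pow_left₀ (norm_nonneg _) (h k) 2

omit [CompleteSpace H] in
theorem le_iff_of_sqrtOp_eq {A B : LinRel H} {T U : H →ₗ.[ℂ] H} (hT : A.sqrtOp = T)
    (hU : B.sqrtOp = U) :
    Le A B ↔ ∃ h : U.domain ≤ T.domain, ∀ f : U.domain, ‖T ⟨f, h f.2⟩‖ ≤ ‖U f‖ := by
  subst hT hU
  rfl

/-- The order of nonnegative selfadjoint relations is that of the operators `I - (I + A)⁻¹`. -/
theorem IsSqrtPair.le_iff {P Q R S : H →L[ℂ] H} (h : IsSqrtPair P Q) (h' : IsSqrtPair R S) :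
    Le (ofPair (P * P) (Q * Q)) (ofPair (R * R) (S * S)) ↔ Q * Q ≤ S * S := by
  have key : Q * Q ≤ S * S ↔ ∀ k, ‖R k‖ ≤ ‖P k‖ := by
    rw [← mul_self_le_mul_self_iff h'.fst_nonneg h.fst_nonneg, h.fst_mul_eq, h'.fst_mul_eq,
      sub_le_sub_iff_left]
  rw [key, le_iff_of_sqrtOp_eq h.sqrtOp_eq h'.sqrtOp_eq]
  constructor
  -- The hypothesis is tested at the vector `R (R f) = P l`. Adding `‖P l‖² = ‖R (R f)‖²` to the
  -- inequality of the square root values gives `‖l‖ ≤ ‖R f‖`, and `‖R f‖² = ⟪R (R f), f⟫ = ⟪l, P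
  -- f⟫` finishes by Cauchy–Schwarz.
  · rintro ⟨hd, hn⟩ f
    have hRf : R f ∈ ((R : H →ₗ[ℂ] H).ker)ᗮ := by
      rw [Submodule.mem_orthogonal]
      intro u hu
      rw [← h'.inner_fst, show R u = 0 from hu, inner_zero_left]
    have hg := h'.mem_domain_opPart (R f)
    obtain ⟨l₀, hl₀⟩ := h.mem_domain_opPart_iff.1 (hd hg)
    obtain ⟨l, hl, hPl, -⟩ := exists_mem_orthogonal_ker P l₀
    rw [hl₀] at hPl
    have h1 := hn ⟨_, hg⟩
    rw [h.opPart_apply hl hPl, h'.opPart_apply hRf rfl] at h1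
    have h2 : ‖l‖ ≤ ‖R f‖ := by
      refine (abs_le_of_sq_le_sq' ?_ (norm_nonneg _)).2
      rw [← h.norm_sq_add, ← h'.norm_sq_add (R f), hPl]
      gcongr
    have h3 : ‖R f‖ ^ 2 ≤ ‖R f‖ * ‖P f‖ := by
      calc ‖R f‖ ^ 2 = (⟪R f, R f⟫_ℂ).re := (inner_self_eq_norm_sq (𝕜 := ℂ) _).symm
        _ = (⟪l, P f⟫_ℂ).re := by rw [← h'.inner_fst, ← hPl, h.inner_fst]
        _ ≤ ‖l‖ * ‖P f‖ := re_inner_le_norm (𝕜 := ℂ) _ _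
        _ ≤ ‖R f‖ * ‖P f‖ := by gcongr
    rcases (norm_nonneg (R f)).eq_or_lt with h0 | h0
    · rw [← h0]
      exact norm_nonneg _
    · rw [sq] at h3
      exact le_of_mul_le_mul_left h3 h0
  · intro hn
    -- Douglas' lemma: `R k = P l` with `‖l‖ ≤ ‖k‖`. Subtracting `‖P l‖² = ‖R k‖²` from the squared
    -- norms leaves `‖Q l‖ ≤ ‖S k‖`.
    have main : ∀ k, ∃ l, ‖l‖ ≤ ‖k‖ ∧ P l = R k := by
      refine ContinuousLinearMap.range_le_range_of_norm_adjoint_le fun f => ?_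
      rw [(IsSelfAdjoint.of_nonneg h.fst_nonneg).adjoint_eq,
        (IsSelfAdjoint.of_nonneg h'.fst_nonneg).adjoint_eq]
      exact hn f
    refine ⟨fun g hg => ?_, fun ⟨g, hg⟩ => ?_⟩
    · obtain ⟨k, rfl⟩ := h'.mem_domain_opPart_iff.1 hg
      obtain ⟨l, -, hl⟩ := main k
      exact h.mem_domain_opPart_iff.2 ⟨l, hl⟩
    · obtain ⟨k₀, hk₀⟩ := h'.mem_domain_opPart_iff.1 hg
      obtain ⟨k, hk, hRk, -⟩ := exists_mem_orthogonal_ker R k₀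
      obtain ⟨l₀, hl₀, hPl₀⟩ := main k
      obtain ⟨l, hl, hPl, hll₀⟩ := exists_mem_orthogonal_ker P l₀
      rw [h'.opPart_apply hk (hRk.trans hk₀),
        h.opPart_apply hl (hPl.trans (hPl₀.trans (hRk.trans hk₀)))]
      refine (abs_le_of_sq_le_sq' ?_ (norm_nonneg _)).2
      have h1 := h.norm_sq_add l
      have h2 := h'.norm_sq_add k
      rw [hPl, hPl₀] at h1
      have h3 : ‖l‖ ^ 2 ≤ ‖k‖ ^ 2 := pow_le_pow_left₀ (norm_nonneg _) (hll₀.trans hl₀) 2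
      linarith

theorem Le.antisymm {A B : LinRel H} (hA : A.NonnegSA) (hB : B.NonnegSA) (h : Le A B)
    (h' : Le B A) : A = B := by
  obtain ⟨P, Q, hPQ, rfl⟩ := hA.exists_isSqrtPair
  obtain ⟨R, S, hRS, rfl⟩ := hB.exists_isSqrtPair
  have e := le_antisymm ((hPQ.le_iff hRS).1 h) ((hRS.le_iff hPQ).1 h')
  rw [hPQ.fst_mul_eq, hRS.fst_mul_eq, e]

end Order

/-! ### Shorted operators. -/

section Shorted

/-- For `Q ≥ 0` and `M = Q⁻¹(L)`, this is the operator `Q²` shorted to `L`. -/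
noncomputable def shorted (Q : H →L[ℂ] H) (M : Submodule ℂ H) [M.HasOrthogonalProjection] :
    H →L[ℂ] H :=
  Q * M.starProjection * Q

variable {Q : H →L[ℂ] H} {L M : Submodule ℂ H} [M.HasOrthogonalProjection]

omit [CompleteSpace H] in
theorem shorted_apply (k : H) : shorted Q M k = Q (M.starProjection (Q k)) := rfl

theorem inner_shorted (hQ : 0 ≤ Q) (k l : H) :
    ⟪shorted Q M k, l⟫_ℂ = ⟪M.starProjection (Q k), M.starProjection (Q l)⟫_ℂ := by
  rw [shorted_apply, ContinuousLinearMap.inner_map_left_of_nonneg hQ,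
    ← Submodule.inner_starProjection_left_eq_right,
    Submodule.starProjection_eq_self_iff.2 (M.starProjection_apply_mem _)]

theorem inner_shorted_right (hQ : 0 ≤ Q) (k l : H) :
    ⟪k, shorted Q M l⟫_ℂ = ⟪M.starProjection (Q k), M.starProjection (Q l)⟫_ℂ := by
  rw [← inner_conj_symm, inner_shorted hQ, inner_conj_symm]

theorem re_inner_shorted (hQ : 0 ≤ Q) (k : H) :
    (⟪shorted Q M k, k⟫_ℂ).re = ‖M.starProjection (Q k)‖ ^ 2 := by
  rw [inner_shorted hQ]
  exact inner_self_eq_norm_sq (𝕜 := ℂ) _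

theorem shorted_nonneg (hQ : 0 ≤ Q) : 0 ≤ shorted Q M := by
  rw [ContinuousLinearMap.nonneg_iff_isPositive, ContinuousLinearMap.isPositive_def]
  refine ⟨fun k l => (inner_shorted hQ k l).trans (inner_shorted_right hQ k l).symm, fun k => ?_⟩
  show 0 ≤ (⟪shorted Q M k, k⟫_ℂ).re
  rw [re_inner_shorted hQ]
  positivity

omit [CompleteSpace H] in
theorem norm_starProjection_le (k : H) : ‖M.starProjection k‖ ≤ ‖k‖ :=
  (ContinuousLinearMap.le_of_opNorm_le _ (Submodule.starProjection_norm_le _) k).trans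
    (by rw [one_mul])

theorem shorted_le (hQ : 0 ≤ Q) : shorted Q M ≤ Q * Q := by
  have sQ := ContinuousLinearMap.inner_map_left_of_nonneg hQ
  rw [ContinuousLinearMap.le_def, ContinuousLinearMap.isPositive_def]
  refine ⟨fun k l => ?_, fun k => ?_⟩
  · show ⟪Q (Q k) - shorted Q M k, l⟫_ℂ = ⟪k, Q (Q l) - shorted Q M l⟫_ℂ
    rw [inner_sub_left, inner_sub_right, sQ, sQ, inner_shorted hQ, inner_shorted_right hQ]
  · show 0 ≤ (⟪Q (Q k) - shorted Q M k, k⟫_ℂ).re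
    rw [inner_sub_left, sQ, Complex.sub_re, re_inner_shorted hQ,
      show (⟪Q k, Q k⟫_ℂ).re = ‖Q k‖ ^ 2 from inner_self_eq_norm_sq (𝕜 := ℂ) _, sub_nonneg]
    exact pow_le_pow_left₀ (norm_nonneg _) (norm_starProjection_le _) 2

omit [CompleteSpace H] in
theorem shorted_mem (hM : ∀ x, x ∈ M ↔ Q x ∈ L) (k : H) : shorted Q M k ∈ L :=
  (hM _).1 (M.starProjection_apply_mem _)

theorem eq_zero_of_mem_orthogonal {Y : H →L[ℂ] H} (hY : 0 ≤ Y)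
    (hYL : (Y : H →ₗ[ℂ] H).range ≤ L) {g : H} (hg : g ∈ Lᗮ) : Y g = 0 := by
  refine ext_inner_left ℂ fun k => ?_
  rw [← ContinuousLinearMap.inner_map_left_of_nonneg hY, inner_zero_right]
  exact (Submodule.mem_orthogonal L g).1 hg _ (hYL ⟨k, rfl⟩)

/-- A competitor `Y` kills `Lᗮ`, so `⟪Y f, f⟫ = ⟪Y (f - g), f - g⟫ ≤ ‖Q f - Q g‖²` for all `g ∈ Lᗮ`.
By continuity `Q g` may be replaced by any vector in the closure of `Q(Lᗮ)`, which contains `Mᗮ`;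
the choice of the `Mᗮ`-component of `Q f` leaves the norm of its projection to `M`. -/
theorem isShortedOp_shorted (hQ : 0 ≤ Q) (hM : ∀ x, x ∈ M ↔ Q x ∈ L)
    (hL : IsClosed (L : Set H)) : IsShortedOp (Q * Q) L (shorted Q M) := by
  have sQ := ContinuousLinearMap.inner_map_left_of_nonneg hQ
  refine ⟨⟨shorted_nonneg hQ, shorted_le hQ, ?_⟩, ?_⟩
  · rintro _ ⟨k, rfl⟩
    exact shorted_mem hM k
  rintro Y ⟨hY0, hY, hYL⟩
  have sY := ContinuousLinearMap.inner_map_left_of_nonneg hY0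
  have : CompleteSpace L := hL.completeSpace_coe
  have hle : Mᗮ ≤ (Lᗮ.map (Q : H →ₗ[ℂ] H)).topologicalClosure := by
    rw [← Submodule.orthogonal_orthogonal_eq_closure]
    refine Submodule.orthogonal_le fun x hx => ?_
    rw [hM, ← L.orthogonal_orthogonal, Submodule.mem_orthogonal]
    intro g hg
    rw [← sQ]
    exact (Submodule.mem_orthogonal _ _).1 hx _ ⟨g, hg, rfl⟩
  have hbound : ∀ f, ∀ z ∈ (Lᗮ.map (Q : H →ₗ[ℂ] H)).topologicalClosure,
      (⟪Y f, f⟫_ℂ).re ≤ ‖Q f - z‖ ^ 2 := by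
    intro f z hz
    have hcl : IsClosed {z : H | (⟪Y f, f⟫_ℂ).re ≤ ‖Q f - z‖ ^ 2} :=
      isClosed_le continuous_const (by fun_prop)
    refine closure_minimal (s := (Lᗮ.map (Q : H →ₗ[ℂ] H) : Set H)) ?_ hcl hz
    rintro _ ⟨g, hg, rfl⟩
    have hYg : Y g = 0 := eq_zero_of_mem_orthogonal hY0 hYL hg
    have h1 := ContinuousLinearMap.re_inner_le_of_le hY (f - g)
    have e1 : ⟪Y (f - g), f - g⟫_ℂ = ⟪Y f, f⟫_ℂ := by
      rw [map_sub, hYg, sub_zero, inner_sub_right, sY f g, hYg, inner_zero_right, sub_zero]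
    have e2 : (⟪(Q * Q) (f - g), f - g⟫_ℂ).re = ‖Q f - Q g‖ ^ 2 := by
      show (⟪Q (Q (f - g)), f - g⟫_ℂ).re = _
      rw [sQ, map_sub]
      exact inner_self_eq_norm_sq (𝕜 := ℂ) _
    rwa [e1, e2] at h1
  rw [ContinuousLinearMap.le_def, ContinuousLinearMap.isPositive_def]
  refine ⟨fun k l => ?_, fun k => ?_⟩
  · show ⟪shorted Q M k - Y k, l⟫_ℂ = ⟪k, shorted Q M l - Y l⟫_ℂ
    rw [inner_sub_left, inner_sub_right, sY, inner_shorted hQ, inner_shorted_right hQ]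
  · show 0 ≤ (⟪shorted Q M k - Y k, k⟫_ℂ).re
    rw [inner_sub_left, Complex.sub_re, re_inner_shorted hQ, sub_nonneg]
    have := hbound k _ (hle (Submodule.sub_starProjection_mem_orthogonal (K := M) (Q k)))
    rwa [sub_sub_cancel] at this

/-- `ran (S_L)^{1/2} = ran S^{1/2} ∩ L`. -/
theorem exists_apply_eq_iff_of_mul_self_eq_shorted {R : H →L[ℂ] H} (hQ : 0 ≤ Q)
    (hM : ∀ x, x ∈ M ↔ Q x ∈ L) (hR : 0 ≤ R) (hRX : R * R = shorted Q M) (y : H) :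
    (∃ k, R k = y) ↔ (∃ k, Q k = y) ∧ y ∈ L := by
  have sR := ContinuousLinearMap.inner_map_left_of_nonneg hR
  have aR := (IsSelfAdjoint.of_nonneg hR).adjoint_eq
  have aT : ContinuousLinearMap.adjoint (Q * M.starProjection) = M.starProjection * Q := by
    rw [← ContinuousLinearMap.star_eq_adjoint, star_mul, (IsSelfAdjoint.of_nonneg hQ).star_eq,
      ContinuousLinearMap.star_eq_adjoint, (isSelfAdjoint_starProjection M).adjoint_eq]
  -- With `T = Q Π`, both `R R†` and `T T†` equal the shorted operator, so `R` and `T` have the same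
  -- range by Douglas' lemma, and `ran T = Q(M)`.
  have hn : ∀ f, ‖ContinuousLinearMap.adjoint R f‖ =
      ‖ContinuousLinearMap.adjoint (Q * M.starProjection) f‖ := fun f => by
    rw [aR, aT]
    have h1 := re_inner_shorted (M := M) hQ f
    rw [← hRX, show (R * R) f = R (R f) from rfl, sR,
      show (⟪R f, R f⟫_ℂ).re = ‖R f‖ ^ 2 from inner_self_eq_norm_sq (𝕜 := ℂ) _] at h1
    exact (pow_left_inj₀ (norm_nonneg _) (norm_nonneg _) two_ne_zero).1 h1
  constructor
  · rintro ⟨k, rfl⟩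
    obtain ⟨z, -, hz⟩ := ContinuousLinearMap.range_le_range_of_norm_adjoint_le
      (fun f => (hn f).le) k
    rw [← hz]
    exact ⟨⟨M.starProjection z, rfl⟩, (hM _).1 (M.starProjection_apply_mem z)⟩
  · rintro ⟨⟨k, rfl⟩, hk⟩
    obtain ⟨z, -, hz⟩ := ContinuousLinearMap.range_le_range_of_norm_adjoint_le
      (fun f => (hn f).ge) k
    refine ⟨z, hz.trans ?_⟩
    show Q (M.starProjection k) = Q k
    rw [Submodule.starProjection_eq_self_iff.2 ((hM k).2 hk)]

/-- Needed because `I` minus the Cayley transform of `A` is `2 Q²` rather than `Q²`. -/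
theorem _root_.IsShortedOp.smul {S X : H →L[ℂ] H} {L : Submodule ℂ H} (h : IsShortedOp S L X)
    {c : ℝ} (hc : 0 < c) : IsShortedOp (c • S) L (c • X) := by
  obtain ⟨⟨h0, h1, h2⟩, h3⟩ := h
  refine ⟨⟨smul_nonneg hc.le h0, smul_le_smul_of_nonneg_left h1 hc.le, ?_⟩, ?_⟩
  · rintro _ ⟨k, rfl⟩
    exact L.smul_of_tower_mem c (h2 ⟨k, rfl⟩)
  · rintro Y ⟨hY0, hY, hYL⟩
    have hc' : 0 ≤ c⁻¹ := (inv_pos.2 hc).le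
    have h4 : c⁻¹ • Y ≤ X := by
      refine h3 ⟨smul_nonneg hc' hY0, ?_, ?_⟩
      · have := smul_le_smul_of_nonneg_left hY hc'
        rwa [inv_smul_smul₀ hc.ne'] at this
      · rintro _ ⟨k, rfl⟩
        exact L.smul_of_tower_mem c⁻¹ (hYL ⟨k, rfl⟩)
    have := smul_le_smul_of_nonneg_left h4 hc.le
    rwa [smul_inv_smul₀ hc.ne'] at this

end Shorted

end LinRel

/-! ### Relations given by pairs of operators, and the Cayley transform. -/

namespace LinRel

variable {H : Type*} [NormedAddCommGroup H] [InnerProductSpace ℂ H]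

theorem one_sub_apply (X : H →L[ℂ] H) (k : H) : (1 - X) k = k - X k := rfl

theorem inv_ofPair (P Q : H →L[ℂ] H) : (ofPair P Q).inv = ofPair Q P := by
  ext x
  rw [mem_ofPair, inv, Submodule.mem_map]
  constructor
  · rintro ⟨y, hy, rfl⟩
    obtain ⟨k, h1, h2⟩ := mem_ofPair.1 hy
    exact ⟨k, h2, h1⟩
  · rintro ⟨k, h1, h2⟩
    exact ⟨(x.2, x.1), mem_ofPair.2 ⟨k, h2, h1⟩, rfl⟩

theorem mem_ran_ofPair {P Q : H →L[ℂ] H} {y : H} : y ∈ (ofPair P Q).ran ↔ ∃ k, Q k = y := by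
  rw [ran, Submodule.mem_map]
  constructor
  · rintro ⟨x, hx, rfl⟩
    obtain ⟨k, -, h2⟩ := mem_ofPair.1 hx
    exact ⟨k, h2⟩
  · rintro ⟨k, rfl⟩
    exact ⟨(P k, Q k), mem_ofPair.2 ⟨k, rfl, rfl⟩, rfl⟩

theorem mem_preimage_ofPair {P Q : H →L[ℂ] H} {L : Submodule ℂ H} {f : H} :
    f ∈ (ofPair P Q).preimage L ↔ ∃ k, Q k ∈ L ∧ P k = f := by
  rw [preimage, Submodule.mem_map]
  constructor
  · rintro ⟨x, ⟨hx, -, hxL⟩, rfl⟩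
    obtain ⟨k, h1, h2⟩ := mem_ofPair.1 hx
    exact ⟨k, by rw [h2]; exact hxL, h1⟩
  · rintro ⟨k, hk, rfl⟩
    exact ⟨(P k, Q k), ⟨mem_ofPair.2 ⟨k, rfl, rfl⟩, trivial, hk⟩, rfl⟩

theorem ofPair_eq_zero_iff (X : H →L[ℂ] H) :
    ofPair (1 - X) X = (⊤ : Submodule ℂ H).prod ⊥ ↔ X = 0 := by
  constructor
  · intro h
    ext k
    have : ((1 - X) k, X k) ∈ (⊤ : Submodule ℂ H).prod ⊥ := h ▸ mem_ofPair.2 ⟨k, rfl, rfl⟩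
    exact this.2
  · rintro rfl
    ext x
    rw [mem_ofPair]
    exact ⟨fun ⟨k, _, h2⟩ => ⟨trivial, h2.symm⟩, fun hx => ⟨x.1, by simp, hx.2.symm⟩⟩

theorem ofOp_eq_zero_iff (S : H →L[ℂ] H) : ofOp S = (⊤ : Submodule ℂ H).prod ⊥ ↔ S = 0 := by
  constructor
  · intro h
    ext k
    have : (k, S k) ∈ (⊤ : Submodule ℂ H).prod ⊥ := h ▸ (rfl : (k, S k).2 = S k)
    exact this.2
  · rintro rfl
    ext x
    exact ⟨fun hx => ⟨trivial, hx⟩, fun hx => hx.2⟩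

theorem mul_ofOp (S : H →L[ℂ] H) : (ofOp S).mul = ⊥ := by
  rw [Submodule.eq_bot_iff]
  intro y hy
  have : y = S 0 := hy
  rw [this, map_zero]

theorem cayley_ofPair_one_sub (X : H →L[ℂ] H) :
    (ofPair (1 - X) X).cayley = ofOp (1 - (2 : ℝ) • X) := by
  have e : ∀ k, (2 : ℝ) • X k = X k + X k := fun k => two_smul ℝ (X k)
  have e' : ∀ k : H, (2 : ℂ) • k = k + k := fun k => two_smul ℂ k
  ext y
  rw [cayley, Submodule.mem_map]
  constructor
  · rintro ⟨x, hx, rfl⟩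
    obtain ⟨k, h1, h2⟩ := mem_ofPair.1 hx
    show -(x.1 + x.2) + (2 : ℂ) • x.1 = (x.1 + x.2) - (2 : ℝ) • X (x.1 + x.2)
    have h3 : x.1 + x.2 = k := by rw [← h1, ← h2]; simp
    rw [h3, e, e', ← h1]
    simp only [one_sub_apply]
    abel
  · intro hy
    have hy' : y.2 = y.1 - (2 : ℝ) • X y.1 := hy
    refine ⟨((1 - X) y.1, X y.1), mem_ofPair.2 ⟨y.1, rfl, rfl⟩, Prod.ext ?_ ?_⟩
    · show (1 - X) y.1 + X y.1 = y.1
      simp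
    · show -((1 - X) y.1 + X y.1) + (2 : ℂ) • (1 - X) y.1 = y.2
      rw [hy', e, e']
      simp only [one_sub_apply]
      abel

/-- The Cayley transform is an involution. Since `f + f' = (1 - X)(2f)` when `f' = f - 2 X f`, the
parameter doubles in one direction and is halved in the other. -/
theorem cayley_ofOp_one_sub (X : H →L[ℂ] H) :
    (ofOp (1 - (2 : ℝ) • X)).cayley = ofPair (1 - X) X := by
  have e : ∀ k, (2 : ℝ) • X k = X k + X k := fun k => two_smul ℝ (X k)
  have e' : ∀ k : H, (2 : ℂ) • k = k + k := fun k => two_smul ℂ k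
  ext y
  rw [cayley, Submodule.mem_map, mem_ofPair]
  constructor
  · rintro ⟨x, hx, rfl⟩
    have hx' : x.2 = x.1 - (2 : ℝ) • X x.1 := hx
    refine ⟨x.1 + x.1, ?_, ?_⟩
    · show (1 - X) (x.1 + x.1) = x.1 + x.2
      rw [hx', e]
      simp only [one_sub_apply, map_add]
      abel
    · show X (x.1 + x.1) = -(x.1 + x.2) + (2 : ℂ) • x.1
      rw [hx', e, e']
      simp only [map_add]
      abel
  · rintro ⟨k, h1, h2⟩
    have h3 : (2⁻¹ : ℂ) • k + (2⁻¹ : ℂ) • k = k := by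
      rw [← e', smul_smul, mul_inv_cancel₀ two_ne_zero, one_smul]
    have h4 : X ((2⁻¹ : ℂ) • k) + X ((2⁻¹ : ℂ) • k) = y.2 := by rw [← map_add, h3, h2]
    have h5 : k - y.2 = y.1 := by rw [← h1, ← h2]; simp
    refine ⟨((2⁻¹ : ℂ) • k, (2⁻¹ : ℂ) • k - (2 : ℝ) • X ((2⁻¹ : ℂ) • k)), rfl, Prod.ext ?_ ?_⟩
    · show (2⁻¹ : ℂ) • k + ((2⁻¹ : ℂ) • k - (2 : ℝ) • X ((2⁻¹ : ℂ) • k)) = y.1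
      rw [e, h4, ← add_sub_assoc, h3, h5]
    · show -((2⁻¹ : ℂ) • k + ((2⁻¹ : ℂ) • k - (2 : ℝ) • X ((2⁻¹ : ℂ) • k))) +
        (2 : ℂ) • (2⁻¹ : ℂ) • k = y.2
      rw [e, h4, ← add_sub_assoc, e', h3]
      abel

variable [CompleteSpace H]

omit [CompleteSpace H] in
theorem nonneg_of_nonnegSA_ofOp {S : H →L[ℂ] H} (hS : (ofOp S).NonnegSA) : 0 ≤ S := by
  rw [ContinuousLinearMap.nonneg_iff_isPositive, ContinuousLinearMap.isPositive_def]
  have hm : ∀ k, (k, S k) ∈ ofOp S := fun k => (rfl : (k, S k).2 = S k)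
  exact ⟨fun k l => (hS.1.mem_iff _).1 (hm l) _ _ (hm k),
    fun k => (Complex.le_def.1 (hS.2 _ (hm k))).1⟩

theorem IsSqrtPair.sqrtOp_apply {P Q : H →L[ℂ] H} (h : IsSqrtPair P Q) {k f : H}
    (hk : k ∈ ((P : H →ₗ[ℂ] H).ker)ᗮ) (hf : P k = f)
    (hd : f ∈ (ofPair (P * P) (Q * Q)).sqrtOp.domain) :
    (ofPair (P * P) (Q * Q)).sqrtOp ⟨f, hd⟩ = Q k := by
  have hmem : (f, Q k) ∈ (ofPair (P * P) (Q * Q)).sqrtOp.graph := by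
    rw [h.sqrtOp_eq, ← hf]
    exact h.mem_graph_opPart hk
  exact LinearPMap.mem_graph_snd_inj _ (LinearPMap.mem_graph _ ⟨f, hd⟩) hmem rfl

theorem NonnegSA.isClosed_graph_sqrtOp {A : LinRel H} (hA : A.NonnegSA) :
    IsClosed (A.sqrtOp.graph : Set (H × H)) := by
  rw [sqrtOp, graph_opPart]
  have h1 := (existsUnique_sqrt hA).1.1.1.isClosed
  have h2 : IsClosed {x : H × H | x.2 ∈ A.sqrt.mulᗮ} :=
    A.sqrt.mul.isClosed_orthogonal.preimage continuous_snd
  convert h1.inter h2 using 1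
  ext x
  simp

end LinRel

/-! ### Closedness of the form of a relation. -/

namespace SesqForm

variable {H : Type*} [NormedAddCommGroup H] [InnerProductSpace ℂ H]

theorem Nonneg.restrict {a : SesqForm H} (ha : a.Nonneg) (L : Submodule ℂ H) :
    (a.restrict L).Nonneg := fun f => ha ⟨(f : L), f.2⟩

theorem Closed.restrict {a : SesqForm H} (ha : a.Closed) (L : Submodule ℂ H) :
    (a.restrict L).Closed := by
  intro φ f hφ hc
  obtain ⟨h, ht⟩ := ha (fun n => ⟨(φ n : L), (φ n).2⟩) f
    ((continuous_subtype_val.tendsto f).comp hφ) hc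
  exact ⟨h, ht⟩

theorem nonneg_ofRel (A : LinRel H) : (ofRel A).Nonneg := fun f => by
  show 0 ≤ ⟪A.sqrtOp f, A.sqrtOp f⟫_ℂ
  exact Complex.nonneg_iff.2 ⟨inner_self_nonneg (𝕜 := ℂ), (inner_self_im (𝕜 := ℂ) _).symm⟩

/-- A form-Cauchy sequence has Cauchy images under the operator `A_o^{1/2}`, whose graph is closed.
-/
theorem closed_ofRel [CompleteSpace H] {A : LinRel H} (hA : A.NonnegSA) : (ofRel A).Closed := by
  intro φ f hφ hc
  change ℕ → A.sqrtOp.domain at φ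
  have hform : ∀ x y : A.sqrtOp.domain, (ofRel A).form (x - y) (x - y) =
      ((‖A.sqrtOp x - A.sqrtOp y‖ ^ 2 : ℝ) : ℂ) := fun x y => by
    show ⟪A.sqrtOp (x - y), A.sqrtOp (x - y)⟫_ℂ = _
    rw [LinearPMap.map_sub, inner_self_eq_norm_sq_to_K]
    norm_cast
  have hcauchy : CauchySeq fun n => A.sqrtOp (φ n) := by
    rw [cauchySeq_iff_tendsto_dist_atTop_0]
    have h1 : Tendsto (fun p : ℕ × ℕ => ‖A.sqrtOp (φ p.1) - A.sqrtOp (φ p.2)‖ ^ 2) atTop (𝓝 0) := by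
      have h2 := (Complex.continuous_re.tendsto 0).comp hc
      rw [Complex.zero_re] at h2
      refine h2.congr fun p => ?_
      exact (congrArg Complex.re (hform (φ p.1) (φ p.2))).trans (Complex.ofReal_re _)
    have h3 := (Real.continuous_sqrt.tendsto 0).comp h1
    rw [Real.sqrt_zero] at h3
    refine h3.congr fun p => ?_
    rw [Function.comp_apply, Real.sqrt_sq (norm_nonneg _), dist_eq_norm]
  obtain ⟨g, hg⟩ := cauchySeq_tendsto_of_complete hcauchy
  have hmem : (f, g) ∈ A.sqrtOp.graph :=
    hA.isClosed_graph_sqrtOp.mem_of_tendsto (hφ.prodMk_nhds hg)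
      (Eventually.of_forall fun n => LinearPMap.mem_graph _ (φ n))
  have hf : f ∈ A.sqrtOp.domain := LinearPMap.mem_domain_of_mem_graph hmem
  have hval : A.sqrtOp ⟨f, hf⟩ = g :=
    LinearPMap.mem_graph_snd_inj _ (LinearPMap.mem_graph _ ⟨f, hf⟩) hmem rfl
  refine ⟨hf, ?_⟩
  have h1 : Tendsto (fun n => ((‖A.sqrtOp (φ n) - g‖ ^ 2 : ℝ) : ℂ)) atTop (𝓝 0) := by
    have h2 : Tendsto (fun n => ‖A.sqrtOp (φ n) - g‖ ^ 2) atTop (𝓝 0) := by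
      simpa using ((tendsto_iff_norm_sub_tendsto_zero.1 hg).pow 2)
    have h3 := (Complex.continuous_ofReal.tendsto 0).comp h2
    rwa [Complex.ofReal_zero] at h3
  refine h1.congr fun n => ?_
  rw [← hval]
  exact (hform (φ n) ⟨f, hf⟩).symm

end SesqForm

/-! ### The relation built from the shorted operator. -/

namespace LinRel

variable {H : Type*} [NormedAddCommGroup H] [InnerProductSpace ℂ H] [CompleteSpace H]
variable {P Q : H →L[ℂ] H} {L M : Submodule ℂ H} [M.HasOrthogonalProjection]

theorem IsSqrtPair.shorted_le_one (h : IsSqrtPair P Q) : shorted Q M ≤ 1 :=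
  (shorted_le h.snd_nonneg).trans h.snd_mul_le

theorem IsSqrtPair.nonnegSA_shorted (h : IsSqrtPair P Q) :
    (ofPair (1 - shorted Q M) (shorted Q M)).NonnegSA :=
  nonnegSA_ofPair_one_sub (shorted_nonneg h.snd_nonneg) h.shorted_le_one

theorem shorted_eq_zero_of_mem_orthogonal (hQ : 0 ≤ Q) (hM : ∀ x, x ∈ M ↔ Q x ∈ L) {g : H}
    (hg : g ∈ Lᗮ) : shorted Q M g = 0 :=
  eq_zero_of_mem_orthogonal (shorted_nonneg hQ) (by rintro _ ⟨k, rfl⟩; exact shorted_mem hM k) hg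

-- Each pair of the relation is a pair in `L × L` plus some `{g, 0}` with `g ∈ Lᗮ`. Such a summand
-- is invisible to vectors of `L`, so testing adjointness inside `L` is the same as testing it in
-- `H`.
omit [CompleteSpace H] in
theorem selfAdj_inside_restr {X : H →L[ℂ] H} [CompleteSpace L] (h : (ofPair (1 - X) X).SelfAdj)
    (hX : ∀ k, X k ∈ L) (hX' : ∀ k ∈ Lᗮ, X k = 0) :
    (((ofPair (1 - X) X).restr L).inside L).SelfAdj := by
  have hmem : ∀ x : L × L, x ∈ ((ofPair (1 - X) X).restr L).inside L ↔
      ((x.1 : H), (x.2 : H)) ∈ ofPair (1 - X) X := fun x =>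
    ⟨fun hx => hx.1, fun hx => ⟨hx, x.1.2, trivial⟩⟩
  show Submodule.adjoint _ = _
  ext x
  rw [Submodule.mem_adjoint_iff, hmem, h.mem_iff]
  constructor
  · rintro hx a b hab
    obtain ⟨k, h1, h2⟩ := mem_ofPair.1 hab
    simp only at h1 h2
    have hk : k - L.starProjection k ∈ Lᗮ := Submodule.sub_starProjection_mem_orthogonal k
    have hXk : X (L.starProjection k) = b := by
      rw [← h2, ← sub_eq_zero, ← map_sub, ← neg_sub k, map_neg, hX' _ hk, neg_zero]
    have ha : a - (k - L.starProjection k) ∈ L := by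
      rw [← h1]
      have : (1 - X) k - (k - L.starProjection k) = L.starProjection k - X k := by
        simp only [one_sub_apply]
        abel
      rw [this]
      exact L.sub_mem (L.starProjection_apply_mem k) (hX k)
    have := hx ⟨_, ha⟩ ⟨b, h2 ▸ hX k⟩ ((hmem _).2 (mem_ofPair.2 ⟨L.starProjection k, ?_, hXk⟩))
    · rw [sub_eq_zero] at this
      simp only [Submodule.coe_inner] at this
      rw [inner_sub_left, (Submodule.mem_orthogonal' _ _).1 hk _ x.2.2, sub_zero] at this
      exact this
    · show (1 - X) (L.starProjection k) = a - (k - L.starProjection k)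
      simp only [one_sub_apply, hXk]
      rw [← h1, ← h2]
      simp only [one_sub_apply]
      abel
  · intro hx a b hab
    rw [sub_eq_zero]
    exact hx a b ((hmem _).1 hab)

/-- Write `ψ = Q m` with `m ∈ M` and `X k = Q n` with `n = Π Q k`, both parameters orthogonal to
`ker Q`. The form value is `⟪P m, P n⟫ = ⟪m, n - Q² n⟫ = ⟪m, Q k⟫ - ⟪m, Q (X k)⟫ = ⟪ψ, (1 - X) k⟫`.
-/
theorem IsSqrtPair.isAssociated_inv (h : IsSqrtPair P Q) (hM : ∀ x, x ∈ M ↔ Q x ∈ L) :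
    ((SesqForm.ofRel (ofPair (P * P) (Q * Q)).inv).restrict L).IsAssociated
      (((ofPair (1 - shorted Q M) (shorted Q M)).restr L).inside L).inv := by
  rw [inv_ofPair]
  refine ⟨(SesqForm.nonneg_ofRel _).restrict L,
    (SesqForm.closed_ofRel h.symm.nonnegSA_mul).restrict L, ?_⟩
  rintro _ ⟨x, hx, rfl⟩
  obtain ⟨k, h1, h2⟩ := mem_ofPair.1 hx.1
  change (1 - shorted Q M) k = (x.1 : H) at h1
  change shorted Q M k = (x.2 : H) at h2
  have hd : (x.2 : H) ∈ (ofPair (Q * Q) (P * P)).sqrtOp.domain := by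
    rw [h.symm.sqrtOp_eq, h.symm.mem_domain_opPart_iff, ← h2]
    exact ⟨_, rfl⟩
  refine ⟨hd, fun ψ => ?_⟩
  have hψd : ((ψ : L) : H) ∈ (ofPair (Q * Q) (P * P)).sqrtOp.domain := ψ.2
  obtain ⟨m₀, hm₀⟩ : ∃ m, Q m = ((ψ : L) : H) := by
    rwa [h.symm.sqrtOp_eq, h.symm.mem_domain_opPart_iff] at hψd
  obtain ⟨m, hm, hQm, -⟩ := exists_mem_orthogonal_ker Q m₀
  rw [hm₀] at hQm
  have hmM : m ∈ M := by
    rw [hM, hQm]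
    exact (ψ : L).2
  -- Holds because `ker Q ⊆ M`, while `Q k ⟂ ker Q`.
  have hn : M.starProjection (Q k) ∈ ((Q : H →ₗ[ℂ] H).ker)ᗮ := by
    rw [Submodule.mem_orthogonal]
    intro z hz
    have hz' : Q z = 0 := hz
    have hzM : z ∈ M := by
      rw [hM, hz']
      exact L.zero_mem
    rw [← Submodule.inner_starProjection_left_eq_right, Submodule.starProjection_eq_self_iff.2 hzM,
      ← h.inner_snd, hz', inner_zero_left]
  show ⟪(ofPair (Q * Q) (P * P)).sqrtOp ⟨_, hψd⟩, (ofPair (Q * Q) (P * P)).sqrtOp ⟨_, hd⟩⟫_ℂ =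
    ⟪((ψ : L) : H), (x.1 : H)⟫_ℂ
  rw [h.symm.sqrtOp_apply hm hQm, h.symm.sqrtOp_apply hn h2, h.inner_fst]
  have h3 : P (P (M.starProjection (Q k))) =
      M.starProjection (Q k) - Q (Q (M.starProjection (Q k))) :=
    eq_sub_of_add_eq (h.apply_sum _)
  rw [h3, inner_sub_right, ← Submodule.inner_starProjection_left_eq_right,
    Submodule.starProjection_eq_self_iff.2 hmM, ← h.inner_snd, ← h.inner_snd, hQm, ← h1,
    ← inner_sub_right]
  rfl

/-- Both sides are `ker P ∩ L`. If `X y = y`, then `‖y‖ = ‖Π Q y‖ ≤ ‖Q y‖`, which forces `P y = 0`;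
on `ker P` the operator `Q` is the identity, so membership in `M` and in `L` agree there. -/
theorem IsSqrtPair.mul_shorted (h : IsSqrtPair P Q) (hM : ∀ x, x ∈ M ↔ Q x ∈ L) :
    (ofPair (1 - shorted Q M) (shorted Q M)).mul = (ofPair (P * P) (Q * Q)).mul ⊓ L := by
  ext y
  rw [Submodule.mem_inf]
  constructor
  · intro hy
    obtain ⟨k, h1, h2⟩ := mem_ofPair.1 (show ((0 : H), y) ∈ ofPair _ _ from hy)
    simp only at h1 h2
    have hXk : shorted Q M k = k := (sub_eq_zero.1 (by simpa using h1)).symm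
    have hyk : y = k := h2.symm.trans hXk
    subst hyk
    have hle : ‖y‖ ^ 2 ≤ ‖Q y‖ ^ 2 := by
      have e := re_inner_shorted (M := M) h.snd_nonneg y
      rw [hXk, show (⟪y, y⟫_ℂ).re = ‖y‖ ^ 2 from inner_self_eq_norm_sq (𝕜 := ℂ) _] at e
      rw [e]
      exact pow_le_pow_left₀ (norm_nonneg _) (norm_starProjection_le _) 2
    have hP : P y = 0 := by
      have := h.norm_sq_add y
      have h0 : ‖P y‖ ^ 2 ≤ 0 := by linarith
      simpa using le_antisymm h0 (sq_nonneg _)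
    have hQ := h.snd_eq_of_fst_eq_zero hP
    refine ⟨mem_ofPair.2 ⟨y, ?_, ?_⟩, h2 ▸ shorted_mem hM y⟩
    · show P (P y) = 0
      rw [hP, map_zero]
    · show Q (Q y) = y
      rw [hQ, hQ]
  · rintro ⟨hy, hyL⟩
    obtain ⟨k, h1, h2⟩ := mem_ofPair.1 (show ((0 : H), y) ∈ ofPair _ _ from hy)
    have hP : P k = 0 := h.fst_eq_zero_iff.1 h1
    have hQ := h.snd_eq_of_fst_eq_zero hP
    have hyk : k = y := by
      refine Eq.trans ?_ h2
      show k = Q (Q k)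
      rw [hQ, hQ]
    subst hyk
    have hX : shorted Q M k = k := by
      rw [shorted_apply, hQ, Submodule.starProjection_eq_self_iff.2 ((hM k).2 (by rwa [hQ])), hQ]
    refine mem_ofPair.2 ⟨k, ?_, hX⟩
    simp [hX]

omit [CompleteSpace H] in
/-- `1 - X` is bounded below when the relation is a bounded operator. -/
theorem exists_norm_sq_le_of_eq_ofOp {X S : H →L[ℂ] H} (hS : 0 ≤ S)
    (hX : ofPair (1 - X) X = ofOp S) :
    ∃ c > 0, ∀ k, c * ‖k‖ ^ 2 ≤ (⟪(1 - X) k, k⟫_ℂ).re := by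
  -- With `f = (1 - X) k` one has `k = f + S f`, so `‖k‖ ≤ (1 + ‖S‖) ‖f‖`, whereas `⟪f, k⟫ ≥ ‖f‖²`
  -- by positivity of `S`.
  refine ⟨((1 + ‖S‖) ^ 2)⁻¹, by positivity, fun k => ?_⟩
  have h1 : X k = S ((1 - X) k) := by
    have : ((1 - X) k, X k) ∈ ofOp S := hX ▸ mem_ofPair.2 ⟨k, rfl, rfl⟩
    exact this
  set f := (1 - X) k with hf
  have hk : k = f + S f := by rw [← h1, hf]; simp
  have h2 : ‖k‖ ≤ (1 + ‖S‖) * ‖f‖ := by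
    rw [hk, add_mul, one_mul]
    exact (norm_add_le _ _).trans (by gcongr; exact S.le_opNorm f)
  have h3 : ‖f‖ ^ 2 ≤ (⟪f, k⟫_ℂ).re := by
    rw [hk, inner_add_right, Complex.add_re,
      show (⟪f, f⟫_ℂ).re = ‖f‖ ^ 2 from inner_self_eq_norm_sq (𝕜 := ℂ) _]
    have := ((ContinuousLinearMap.nonneg_iff_isPositive S).1 hS).re_inner_nonneg_right f
    linarith [show 0 ≤ (⟪f, S f⟫_ℂ).re from this]
  refine le_trans ?_ h3
  rw [inv_mul_le_iff₀ (by positivity), ← mul_pow]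
  exact pow_le_pow_left₀ (norm_nonneg _) h2 2

/-- The Neumann series inverts `1 - X`, and the operator is `X (1 - X)⁻¹`. -/
theorem exists_eq_ofOp_of_norm_lt_one {X : H →L[ℂ] H} (h : (ofPair (1 - X) X).NonnegSA)
    (hX : ‖X‖ < 1) : ∃ S : H →L[ℂ] H, 0 ≤ S ∧ ofPair (1 - X) X = ofOp S := by
  obtain ⟨u, hu⟩ := isUnit_one_sub_of_norm_lt_one hX
  have h1 : ∀ k, (1 - X) ((↑u⁻¹ : H →L[ℂ] H) k) = k := fun k => by
    rw [← hu]
    exact congrArg (fun T : H →L[ℂ] H => T k) u.mul_inv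
  have h2 : ∀ k, (↑u⁻¹ : H →L[ℂ] H) ((1 - X) k) = k := fun k => by
    rw [← hu]
    exact congrArg (fun T : H →L[ℂ] H => T k) u.inv_mul
  have e : ofPair (1 - X) X = ofOp (X * (↑u⁻¹ : H →L[ℂ] H)) := by
    ext y
    rw [mem_ofPair]
    constructor
    · rintro ⟨k, hk, hk'⟩
      show y.2 = X ((↑u⁻¹ : H →L[ℂ] H) y.1)
      rw [← hk, h2, hk']
    · intro hy
      exact ⟨(↑u⁻¹ : H →L[ℂ] H) y.1, h1 _, (show y.2 = X ((↑u⁻¹ : H →L[ℂ] H) y.1) from hy).symm⟩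
  exact ⟨_, nonneg_of_nonnegSA_ofOp (e ▸ h), e⟩

/-- The preimage is `P(M)`. The bound `1 - X ≥ c` says `‖Π Q k‖² ≤ (1 - c) ‖k‖²`; by duality `Q Π`
obeys the same bound, so `‖P m‖² ≥ c ‖m‖²` on the complete space `M`. -/
theorem IsSqrtPair.isClosed_preimage_of_eq_ofOp (h : IsSqrtPair P Q) (hM : ∀ x, x ∈ M ↔ Q x ∈ L)
    (hMc : IsClosed (M : Set H)) {S : H →L[ℂ] H} (hS : 0 ≤ S)
    (hX : ofPair (1 - shorted Q M) (shorted Q M) = ofOp S) :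
    IsClosed ((ofPair P Q).preimage L : Set H) := by
  obtain ⟨c, hc, hcX⟩ := exists_norm_sq_le_of_eq_ofOp hS hX
  have h1 : ∀ k, ‖M.starProjection (Q k)‖ ^ 2 ≤ (1 - c) * ‖k‖ ^ 2 := fun k => by
    have := hcX k
    rw [one_sub_apply, inner_sub_left, Complex.sub_re, re_inner_shorted h.snd_nonneg,
      show (⟪k, k⟫_ℂ).re = ‖k‖ ^ 2 from inner_self_eq_norm_sq (𝕜 := ℂ) _] at this
    linarith
  have h2 : ∀ m ∈ M, c * ‖m‖ ^ 2 ≤ ‖P m‖ ^ 2 := fun m hm => by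
    have e : ‖Q m‖ ^ 2 ≤ ‖m‖ * ‖M.starProjection (Q (Q m))‖ := by
      calc ‖Q m‖ ^ 2 = (⟪Q m, Q m⟫_ℂ).re := (inner_self_eq_norm_sq (𝕜 := ℂ) _).symm
        _ = (⟪m, M.starProjection (Q (Q m))⟫_ℂ).re := by
          rw [h.inner_snd, ← Submodule.inner_starProjection_left_eq_right,
            Submodule.starProjection_eq_self_iff.2 hm]
        _ ≤ _ := re_inner_le_norm (𝕜 := ℂ) _ _
    have e2 : ‖Q m‖ ^ 2 * ‖Q m‖ ^ 2 ≤ ‖Q m‖ ^ 2 * ((1 - c) * ‖m‖ ^ 2) := by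
      calc ‖Q m‖ ^ 2 * ‖Q m‖ ^ 2 ≤
            (‖m‖ * ‖M.starProjection (Q (Q m))‖) * (‖m‖ * ‖M.starProjection (Q (Q m))‖) := by
              gcongr
        _ = ‖m‖ ^ 2 * ‖M.starProjection (Q (Q m))‖ ^ 2 := by ring
        _ ≤ ‖m‖ ^ 2 * ((1 - c) * ‖Q m‖ ^ 2) := by gcongr; exact h1 _
        _ = _ := by ring
    have h3 := h.norm_sq_add m
    -- The duality estimate is cancelled by `‖Q m‖²`. When that is zero, `‖P m‖ = ‖m‖`, and `h1`
    -- still gives `c ‖m‖² ≤ ‖m‖²`.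
    rcases (sq_nonneg ‖Q m‖).eq_or_lt with h0 | h0
    · have := h1 m
      have h4 : 0 ≤ (1 - c) * ‖m‖ ^ 2 := (sq_nonneg _).trans this
      nlinarith
    · have := le_of_mul_le_mul_left e2 h0
      linarith
  have : CompleteSpace M := hMc.completeSpace_coe
  let g : M →L[ℂ] H := P.comp M.subtypeL
  have hanti : AntilipschitzWith (Real.toNNReal (√c)⁻¹) g := by
    refine AddMonoidHomClass.antilipschitz_of_bound g fun m => ?_
    have h0 := Real.sqrt_pos.2 hc
    rw [Real.coe_toNNReal _ (inv_pos.2 h0).le, inv_mul_eq_div, le_div_iff₀ h0]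
    refine (abs_le_of_sq_le_sq' ?_ (norm_nonneg _)).2
    rw [mul_pow, Real.sq_sqrt hc.le, mul_comm]
    exact h2 m m.2
  have hr := hanti.isClosed_range g.uniformContinuous
  convert hr using 1
  ext f
  rw [SetLike.mem_coe, mem_preimage_ofPair]
  constructor
  · rintro ⟨k, hk, rfl⟩
    exact ⟨⟨k, (hM k).2 hk⟩, rfl⟩
  · rintro ⟨m, rfl⟩
    exact ⟨m, (hM m).1 m.2, rfl⟩

/-- On `M` the operator `P` is injective, its kernel there lying in `mul A ∩ L`, and has closed
range, so it is bounded below. Hence `Q` is a strict contraction on `M`, and so is `Π Q` by duality;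
`X` is their product. -/
theorem IsSqrtPair.norm_shorted_lt_one (h : IsSqrtPair P Q) (hM : ∀ x, x ∈ M ↔ Q x ∈ L)
    (hMc : IsClosed (M : Set H)) (hcl : IsClosed ((ofPair P Q).preimage L : Set H))
    (hmul : (ofPair (P * P) (Q * Q)).mul ⊓ L = ⊥) : ‖shorted Q M‖ < 1 := by
  have : CompleteSpace M := hMc.completeSpace_coe
  let g : M →L[ℂ] H := P.comp M.subtypeL
  have hinj : Function.Injective g := by
    refine (injective_iff_map_eq_zero g).2 fun m hm => ?_
    have hP : P m = 0 := hm
    have hQ := h.snd_eq_of_fst_eq_zero hP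
    have hmem : (m : H) ∈ (ofPair (P * P) (Q * Q)).mul ⊓ L := by
      refine ⟨mem_ofPair.2 ⟨m, ?_, ?_⟩, ?_⟩
      · show P (P m) = 0
        rw [hP, map_zero]
      · show Q (Q m) = m
        rw [hQ, hQ]
      · rw [← hQ]
        exact (hM m).1 m.2
    rw [hmul, Submodule.mem_bot] at hmem
    exact Subtype.ext hmem
  have hr : IsClosed (Set.range g) := by
    convert hcl using 1
    ext f
    rw [SetLike.mem_coe, mem_preimage_ofPair]
    constructor
    · rintro ⟨m, rfl⟩
      exact ⟨m, (hM m).1 m.2, rfl⟩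
    · rintro ⟨k, hk, rfl⟩
      exact ⟨⟨k, (hM k).2 hk⟩, rfl⟩
  obtain ⟨K, hK⟩ := g.antilipschitz_of_injective_of_isClosed_range hinj hr
  have hK' : ∀ m ∈ M, ‖m‖ ≤ K * ‖P m‖ := fun m hm =>
    hK.le_mul_norm (map_zero g) ⟨m, hm⟩
  -- The summand `1` keeps `c` in `(0, 1]` even when `K = 0`, so that `√(1 - c)` is a genuine
  -- contraction constant.
  set c : ℝ := (1 + (K : ℝ) ^ 2)⁻¹ with hc
  have hc0 : 0 < c := by positivity
  have hc1 : c ≤ 1 := inv_le_one_of_one_le₀ (by nlinarith [sq_nonneg (K : ℝ)])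
  have hlow : ∀ m ∈ M, ‖Q m‖ ≤ √(1 - c) * ‖m‖ := fun m hm => by
    have h1 : ‖m‖ ^ 2 ≤ (1 + (K : ℝ) ^ 2) * ‖P m‖ ^ 2 := by
      have := pow_le_pow_left₀ (norm_nonneg _) (hK' m hm) 2
      rw [mul_pow] at this
      nlinarith [sq_nonneg ‖P m‖]
    have h2 : c * ‖m‖ ^ 2 ≤ ‖P m‖ ^ 2 := by
      rwa [hc, inv_mul_le_iff₀ (by positivity)]
    refine (abs_le_of_sq_le_sq' ?_ (by positivity)).2
    rw [mul_pow, Real.sq_sqrt (by linarith)]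
    linarith [h.norm_sq_add m]
  have hbound : ∀ k, ‖shorted Q M k‖ ≤ (1 - c) * ‖k‖ := fun k => by
    set m := M.starProjection (Q k) with hm
    have hmM : m ∈ M := M.starProjection_apply_mem _
    have h1 : ‖m‖ ^ 2 ≤ ‖m‖ * (√(1 - c) * ‖k‖) := by
      calc ‖m‖ ^ 2 = (⟪m, m⟫_ℂ).re := (inner_self_eq_norm_sq (𝕜 := ℂ) _).symm
        _ = (⟪Q m, k⟫_ℂ).re := by
          nth_rewrite 2 [hm]
          rw [← Submodule.inner_starProjection_left_eq_right,
            Submodule.starProjection_eq_self_iff.2 hmM, h.inner_snd]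
        _ ≤ ‖Q m‖ * ‖k‖ := re_inner_le_norm (𝕜 := ℂ) _ _
        _ ≤ (√(1 - c) * ‖m‖) * ‖k‖ := by gcongr; exact hlow m hmM
        _ = _ := by ring
    have h2 : ‖m‖ ≤ √(1 - c) * ‖k‖ := by
      rcases (norm_nonneg m).eq_or_lt with h0 | h0
      · rw [← h0]
        positivity
      · rw [sq] at h1
        exact le_of_mul_le_mul_left h1 h0
    calc ‖shorted Q M k‖ = ‖Q m‖ := rfl
      _ ≤ √(1 - c) * ‖m‖ := hlow m hmM
      _ ≤ √(1 - c) * (√(1 - c) * ‖k‖) := by gcongr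
      _ = (1 - c) * ‖k‖ := by rw [← mul_assoc, Real.mul_self_sqrt (by linarith)]
  exact (ContinuousLinearMap.opNorm_le_bound _ (by linarith) hbound).trans_lt (by linarith)

theorem IsSqrtPair.exists_eq_ofOp_iff (h : IsSqrtPair P Q) (hM : ∀ x, x ∈ M ↔ Q x ∈ L)
    (hMc : IsClosed (M : Set H)) :
    (∃ S : H →L[ℂ] H, 0 ≤ S ∧ ofPair (1 - shorted Q M) (shorted Q M) = ofOp S) ↔
      IsClosed ((ofPair P Q).preimage L : Set H) ∧ (ofPair (P * P) (Q * Q)).mul ⊓ L = ⊥ := by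
  constructor
  · rintro ⟨S, hS, hX⟩
    exact ⟨h.isClosed_preimage_of_eq_ofOp hM hMc hS hX, by rw [← h.mul_shorted hM, hX, mul_ofOp]⟩
  · rintro ⟨hcl, hmul⟩
    exact exists_eq_ofOp_of_norm_lt_one h.nonnegSA_shorted
      (h.norm_shorted_lt_one hM hMc hcl hmul)

/-- The relation obtained from the shorted operator is the greatest element of `Ξ(A, L)`. -/
theorem IsSqrtPair.isGreatest_Xi (h : IsSqrtPair P Q) (hM : ∀ x, x ∈ M ↔ Q x ∈ L)
    (hL : IsClosed (L : Set H)) :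
    ofPair (1 - shorted Q M) (shorted Q M) ∈ (ofPair (P * P) (Q * Q)).Xi L ∧
      ∀ B ∈ (ofPair (P * P) (Q * Q)).Xi L, B.Le (ofPair (1 - shorted Q M) (shorted Q M)) := by
  obtain ⟨hX, hmax⟩ := isShortedOp_shorted h.snd_nonneg hM hL
  obtain ⟨R, S, hRS, hR, hS⟩ := exists_isSqrtPair hX.1 (h.shorted_le_one (M := M))
  rw [← hR, ← hS]
  refine ⟨⟨hRS.nonnegSA_mul, (hRS.le_iff h).2 (by rw [hS]; exact hX.2.1), fun y hy => ?_⟩, ?_⟩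
  · obtain ⟨k, rfl⟩ := mem_ran_ofPair.1 hy
    rw [hS]
    exact shorted_mem hM k
  · rintro B ⟨hB, hBA, hBL⟩
    obtain ⟨U, V, hUV, rfl⟩ := hB.exists_isSqrtPair
    rw [hUV.le_iff hRS, hS]
    -- The competitor for shorting is `V² = I - (I + B)⁻¹`, whose range is that of `B`.
    refine hmax ⟨hUV.snd_mul_nonneg, (hUV.le_iff h).1 hBA, ?_⟩
    rintro _ ⟨k, rfl⟩
    exact hBL (mem_ran_ofPair.2 ⟨k, rfl⟩)

theorem IsSqrtPair.ran_sqrt_shorted (h : IsSqrtPair P Q) (hM : ∀ x, x ∈ M ↔ Q x ∈ L) :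
    (ofPair (1 - shorted Q M) (shorted Q M)).sqrt.ran = (ofPair P Q).ran ⊓ L := by
  obtain ⟨R, S, hRS, hR, hS⟩ :=
    exists_isSqrtPair (shorted_nonneg h.snd_nonneg) (h.shorted_le_one (M := M))
  ext y
  rw [← hR, ← hS, hRS.sqrt_eq, Submodule.mem_inf, mem_ran_ofPair, mem_ran_ofPair]
  exact exists_apply_eq_iff_of_mul_self_eq_shorted h.snd_nonneg hM hRS.snd_nonneg hS y

/-- If `X = 0`, then `Π Q = 0`, so for `k ∈ M` one gets `‖Q k‖² = ⟪k, Π Q (Q k)⟫ = 0`. Conversely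
every `X k` lies in `ran Q ∩ L`. -/
theorem IsSqrtPair.shorted_eq_zero_iff (h : IsSqrtPair P Q) (hM : ∀ x, x ∈ M ↔ Q x ∈ L) :
    ofPair (1 - shorted Q M) (shorted Q M) = (⊤ : Submodule ℂ H).prod ⊥ ↔
      (ofPair P Q).ran ⊓ L = ⊥ := by
  rw [ofPair_eq_zero_iff, Submodule.eq_bot_iff]
  constructor
  · rintro h0 y ⟨hy, hyL⟩
    obtain ⟨k, rfl⟩ := mem_ran_ofPair.1 hy
    have hk : M.starProjection k = k := Submodule.starProjection_eq_self_iff.2 ((hM k).2 hyL)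
    have h1 := re_inner_shorted (M := M) h.snd_nonneg (Q k)
    rw [h0, zero_apply, inner_zero_left, Complex.zero_re, eq_comm, sq_eq_zero_iff,
      norm_eq_zero] at h1
    refine (inner_self_eq_zero (𝕜 := ℂ)).1 ?_
    rw [h.inner_snd, ← hk, Submodule.inner_starProjection_left_eq_right, hk, h1, inner_zero_right]
  · intro h0
    ext k
    exact h0 _ ⟨mem_ran_ofPair.2 ⟨_, rfl⟩, shorted_mem hM k⟩

end LinRel

/-! ### Assembly of the theorem. -/

theorem theorem3p1 {H : Type*} [NormedAddCommGroup H] [InnerProductSpace ℂ H] [CompleteSpace H]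
    (A : LinRel H) (hA : A.NonnegSA) (L : Submodule ℂ H) (hL : IsClosed (L : Set H)) :
    ∃ AL : LinRel H,
      -- `AL` is the greatest element of `Ξ(A, L)`, and its unique maximal element
      (AL ∈ A.Xi L ∧ ∀ B ∈ A.Xi L, B.Le AL) ∧
      (∀ M ∈ A.Xi L, (∀ B ∈ A.Xi L, M.Le B → B = M) ↔ M = AL) ∧
      Lᗮ ≤ AL.ker ∧
      -- (1)
      (AL.restr L ≤ L.prod L ∧ ((AL.restr L).inside L).SelfAdj ∧
        ((SesqForm.ofRel A.inv).restrict L).domain = A.sqrt.ran.comap L.subtype ∧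
        ((SesqForm.ofRel A.inv).restrict L).IsAssociated ((AL.restr L).inside L).inv) ∧
      -- (2)
      (AL.sqrt.ran = A.sqrt.ran ⊓ L ∧
        (AL = (⊤ : Submodule ℂ H).prod ⊥ ↔ A.sqrt.ran ⊓ L = ⊥)) ∧
      -- (3)
      (∃ T S : H →L[ℂ] H, A.cayley = LinRel.ofOp T ∧ IsShortedOp (1 - T) L S ∧
        AL = (LinRel.ofOp (1 - S)).cayley) ∧
      -- (4)
      (AL.mul = ⊥ ↔ A.mul ⊓ L = ⊥) ∧
      -- (5)
      ((∃ S : H →L[ℂ] H, 0 ≤ S ∧ AL = LinRel.ofOp S) ↔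
        IsClosed (A.sqrt.preimage L : Set H) ∧ A.mul ⊓ L = ⊥) ∧
      ((∃ S : H →L[ℂ] H, 0 ≤ S ∧ S ≠ 0 ∧ AL = LinRel.ofOp S) ↔
        IsClosed (A.sqrt.preimage L : Set H) ∧ A.mul ⊓ L = ⊥ ∧ A.sqrt.ran ⊓ L ≠ ⊥) := by
  obtain ⟨P, Q, h, rfl⟩ := hA.exists_isSqrtPair
  have hMc : IsClosed ((L.comap (Q : H →ₗ[ℂ] H) : Submodule ℂ H) : Set H) :=
    hL.preimage Q.continuous
  have : CompleteSpace (L.comap (Q : H →ₗ[ℂ] H)) := hMc.completeSpace_coe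
  have : CompleteSpace L := hL.completeSpace_coe
  have hM : ∀ x, x ∈ L.comap (Q : H →ₗ[ℂ] H) ↔ Q x ∈ L := fun x => Iff.rfl
  generalize L.comap (Q : H →ₗ[ℂ] H) = M at *
  have hgr := h.isGreatest_Xi hM hL
  have hSA := hgr.1.1
  have hbdd := h.exists_eq_ofOp_iff hM hMc
  have hzero := h.shorted_eq_zero_iff hM
  have hshort := (LinRel.isShortedOp_shorted h.snd_nonneg hM hL).smul two_pos
  rw [h.sqrt_eq]
  refine ⟨LinRel.ofPair (1 - LinRel.shorted Q M) (LinRel.shorted Q M), hgr, fun B hB => ?_, ?_,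
    ⟨?_, ?_, ?_, h.isAssociated_inv hM⟩, ⟨h.ran_sqrt_shorted hM, hzero⟩, ?_, ?_, hbdd, ?_⟩
  · constructor
    · exact fun hmax => (hmax _ hgr.1 (hgr.2 B hB)).symm
    · rintro rfl C hC hle
      exact (hgr.2 C hC).antisymm hC.1 hSA hle
  · intro g hg
    have hX := LinRel.shorted_eq_zero_of_mem_orthogonal h.snd_nonneg hM hg
    exact LinRel.mem_ofPair.2 ⟨g, by simp [hX], hX⟩
  · rintro x ⟨hx, hxL, -⟩
    obtain ⟨k, -, hk⟩ := LinRel.mem_ofPair.1 hx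
    exact ⟨hxL, hk ▸ LinRel.shorted_mem hM k⟩
  · exact LinRel.selfAdj_inside_restr hSA.1 (LinRel.shorted_mem hM)
      fun k hk => LinRel.shorted_eq_zero_of_mem_orthogonal h.snd_nonneg hM hk
  · ext f
    show (f : H) ∈ (LinRel.ofPair (P * P) (Q * Q)).inv.sqrtOp.domain ↔
      (f : H) ∈ (LinRel.ofPair P Q).ran
    rw [LinRel.inv_ofPair, h.symm.sqrtOp_eq, h.symm.mem_domain_opPart_iff, LinRel.mem_ran_ofPair]
  -- The Cayley transform of `A` is `1 - 2 Q²`, so the operator to be shorted is `2 Q²`, and its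
  -- shorted operator is `2 X`.
  · refine ⟨1 - (2 : ℝ) • (Q * Q), (2 : ℝ) • LinRel.shorted Q M, ?_, ?_, ?_⟩
    · rw [h.fst_mul_eq, LinRel.cayley_ofPair_one_sub]
    · rwa [sub_sub_cancel]
    · rw [LinRel.cayley_ofOp_one_sub]
  · rw [h.mul_shorted hM]
  · rw [← and_assoc, ← hbdd, ne_eq, ← hzero]
    constructor
    · rintro ⟨S, hS, hS0, hX⟩
      exact ⟨⟨S, hS, hX⟩, by rwa [hX, LinRel.ofOp_eq_zero_iff]⟩
    · rintro ⟨⟨S, hS, hX⟩, h0⟩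
      exact ⟨S, hS, by rwa [hX, LinRel.ofOp_eq_zero_iff] at h0, hX⟩
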